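/- Let $X,Z,W$ be complex Banach spaces, $\tau\in(0,\infty]$, and let $-A$ generate a bounded analytic semigroup $T(\cdot)$ on $X$, not necessarily strongly continuous at $0$ (so $A$ need not be densely defined); put $T(0)=I$. That is, $T$ extends to a bounded holomorphic operator family on an open sector about $(0,\infty)$, satisfies $T(s+t)=T(s)T(t)$ for $s,t>0$, and $(\mu+A)^{-1}x=\int_0^\infty e^{-\mu t}T(t)x\,dt$ for all $\mu>0$, $x\in X$. Let $X_1=D(A)$ with norm $\|(I+A)x\|$, and let $X_{-1}$ be the extrapolation space, i.e. the Banach space containing $X$ such that $I+A$ extends to an isometric isomorphism $I+A_{-1}:X\to X_{-1}$; let $T_{-1}(t)=(I+A_{-1})T(t)(I+A_{-1})^{-1}$ on $X_{-1}$. Let $B:W\to X_{-1}$ be bounded and linear, let $C$ be a closed linear operator from $X$ to $Z$ with $D(A)\subseteq D(C)$ that is bounded $X_1\to Z$, and let $F:Z\times Z\to W$ be a bounded bilinear map. For a Banach space $E$ and an interval $J\subseteq(0,\infty)$ let $L^p_\alpha(J,E)$ be the space of measurable $f:J\to E$ with $t^\alpha f(t)\in L^p(J,E)$, with norm $\|t\mapsto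 t^\alpha f(t)\|_{L^p(J,E)}$. Let $p\in(2,\infty]$ and $\alpha\ge0$ with $\alpha+\frac1p\in(0,\frac12)$ (where $\frac1\infty=0$), and assume: [A1] the map $x\mapsto CT(\cdot)x$ is bounded $X\to L^p_\alpha((0,\tau),Z)$; [A2] the map $u\mapsto (T_{-1}(\cdot)B)*u=\int_0^{\,\cdot}T_{-1}(\cdot-s)Bu(s)\,ds$ (Bochner integral in $X_{-1}$) is bounded $L^{p/2}_{2\alpha}((0,\tau),W)\to L^\infty((0,\tau),X)$; [A3] the map $u\mapsto (CT_{-1}(\cdot)B)*u=\int_0^{\,\cdot}CT_{-1}(\cdot-s)Bu(s)\,ds$ (Bochner integral in $Z$, convergent almost everywhere) is bounded $L^{p/2}_{2\alpha}((0,\tau),W)\to L^p_\alpha((0,\tau),Z)$. Let $X^\flat$ be the closure of $D(A)$ in $X$. For $x_0\in X^\flat$ and $\eta\in(0,\tau]$, call $x\in C([0,\eta),X^\flat)$ a mild solution on $[0,\eta)$ if $x(t)\in D(C)$ for almost every $t\in(0,\eta)$, $Cx\in L^p_\alpha((0,\eta),Z)$, and $$x(t)=T(t)x_0+\int_0^tT_{-1}(t-s)B\,F(Cx(s),Cx(s))\,ds\qquad\text{in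 }X_{-1}\text{ for all }t\in[0,\eta).$$ Then: (1) for every $x_0\in X^\flat$ there is $\eta\in(0,\tau]$ such that a mild solution on $[0,\eta)$ exists; (2) for every $x_0\in X^\flat$ and every $\eta\in(0,\tau]$ there is at most one mild solution on $[0,\eta)$; (3) there is $\delta>0$ such that for every $x_0\in X^\flat$ with $\|x_0\|_X<\delta$ a mild solution on the whole interval $[0,\tau)$ exists. -/

import Mathlib

open MeasureTheory Set
open scoped ENNReal NNReal

namespace AbstractKato

noncomputable section

/-! ### Unbounded operators -/

/-- The value `C x` of an unbounded operator, extended by `0` outside of the domain. -/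
def app {E G : Type*} [AddCommGroup E] [Module ℂ E] [AddCommGroup G] [Module ℂ G]
    (C : E →ₗ.[ℂ] G) (x : E) : G :=
  open Classical in if h : x ∈ C.domain then C ⟨x, h⟩ else 0

/-- `R` is the bounded, everywhere defined, two-sided inverse of `μ + A : D(A) → X`. -/
def IsInverseOfShift {X : Type*} [NormedAddCommGroup X] [NormedSpace ℂ X]
    (A : X →ₗ.[ℂ] X) (μ : ℂ) (R : X →L[ℂ] X) : Prop :=
  (∀ x : X, R x ∈ A.domain ∧ μ • R x + app A (R x) = x) ∧
    ∀ y : A.domain, R (μ • (y : X) + A y) = y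

/-- The operator `(I + A)⁻¹`; it is only used if `I + A` is boundedly invertible
(junk value `0` otherwise). -/
def shiftInv {X : Type*} [NormedAddCommGroup X] [NormedSpace ℂ X]
    (A : X →ₗ.[ℂ] X) : X →L[ℂ] X :=
  open Classical in
  if h : ∃ R : X →L[ℂ] X, IsInverseOfShift A 1 R then h.choose else 0

/-! ### Bounded analytic semigroups that need not be strongly continuous at `0` -/

/-- The open sector of angle `2 θ` about the positive real axis. -/
def sector (θ : ℝ) : Set ℂ := {z | z ≠ 0 ∧ |z.arg| < θ}

/-- `-A` generates the bounded analytic semigroup `T`. The family `T` is extended by `T 0 = I`; it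
is not required to be strongly continuous at `0`, and `A` is not required to be densely defined.
That `-A` is the generator means that the Laplace transform of `T` is the resolvent of `-A`. -/
structure GeneratesBoundedAnalyticSemigroup
    {X : Type*} [NormedAddCommGroup X] [NormedSpace ℂ X]
    (A : X →ₗ.[ℂ] X) (T : ℝ → X →L[ℂ] X) : Prop where
  map_zero : T 0 = ContinuousLinearMap.id ℂ X
  map_add : ∀ s t : ℝ, 0 < s → 0 < t → T (s + t) = (T s).comp (T t)
  analytic : ∃ θ : ℝ, 0 < θ ∧ θ ≤ Real.pi / 2 ∧ ∃ S : ℂ → X →L[ℂ] X,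
    DifferentiableOn ℂ S (sector θ) ∧
    (∃ M : ℝ, ∀ z ∈ sector θ, ‖S z‖ ≤ M) ∧
    ∀ t : ℝ, 0 < t → S (t : ℂ) = T t
  generator : ∀ μ : ℝ, 0 < μ → ∃ R : X →L[ℂ] X, IsInverseOfShift A (μ : ℂ) R ∧
    ∀ x : X, R x = ∫ t in Ioi (0 : ℝ), Real.exp (-(μ * t)) • T t x

/-! ### The extrapolation space `X₋₁` -/

/-- The extrapolation space `X₋₁ = (I + A₋₁)(X)` with its natural norm `‖(I + A₋₁) x‖ = ‖x‖_X`: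
a copy of `X` (see `shiftIso`), into which `X` is embedded by `embed`. -/
def Extrap {X : Type*} [NormedAddCommGroup X] [NormedSpace ℂ X] (_A : X →ₗ.[ℂ] X) : Type _ := X

instance {X : Type*} [NormedAddCommGroup X] [NormedSpace ℂ X] (A : X →ₗ.[ℂ] X) :
    NormedAddCommGroup (Extrap A) := inferInstanceAs (NormedAddCommGroup X)

instance {X : Type*} [NormedAddCommGroup X] [NormedSpace ℂ X] (A : X →ₗ.[ℂ] X) :
    NormedSpace ℂ (Extrap A) := inferInstanceAs (NormedSpace ℂ X)

instance {X : Type*} [NormedAddCommGroup X] [NormedSpace ℂ X] [CompleteSpace X]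
    (A : X →ₗ.[ℂ] X) : CompleteSpace (Extrap A) := inferInstanceAs (CompleteSpace X)

/-- The isometric isomorphism `I + A₋₁ : X → X₋₁`. -/
def shiftIso {X : Type*} [NormedAddCommGroup X] [NormedSpace ℂ X] (A : X →ₗ.[ℂ] X) :
    X ≃ₗᵢ[ℂ] Extrap A := LinearIsometryEquiv.refl ℂ X

/-- The canonical embedding `X → X₋₁`, `x = (I + A₋₁) (I + A)⁻¹ x`. -/
def embed {X : Type*} [NormedAddCommGroup X] [NormedSpace ℂ X] (A : X →ₗ.[ℂ] X) :
    X →L[ℂ] Extrap A :=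
  ((shiftIso A).toContinuousLinearEquiv : X →L[ℂ] Extrap A).comp (shiftInv A)

/-- The extrapolated semigroup `T₋₁(t) = (I + A₋₁) T(t) (I + A₋₁)⁻¹` on `X₋₁`. -/
def extrapSemigroup {X : Type*} [NormedAddCommGroup X] [NormedSpace ℂ X] (A : X →ₗ.[ℂ] X)
    (T : ℝ → X →L[ℂ] X) (t : ℝ) : Extrap A →L[ℂ] Extrap A :=
  ((shiftIso A).toContinuousLinearEquiv : X →L[ℂ] Extrap A).comp
    ((T t).comp ((shiftIso A).symm.toContinuousLinearEquiv : Extrap A →L[ℂ] X))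

/-- An element of `X₋₁` that lies in `X`, regarded as an element of `X`. -/
def toBase {X : Type*} [NormedAddCommGroup X] [NormedSpace ℂ X] (A : X →ₗ.[ℂ] X) :
    Extrap A → X :=
  Function.invFun (embed A)

/-! ### Weighted Lebesgue–Bochner spaces -/

/-- The open time interval `(0, τ)`, where `0 < τ ≤ ∞`. -/
def openTime (τ : EReal) : Set ℝ := {t | 0 < t ∧ (t : EReal) < τ}

/-- The half-open time interval `[0, τ)`, where `0 < τ ≤ ∞`. -/
def halfOpenTime (τ : EReal) : Set ℝ := {t | 0 ≤ t ∧ (t : EReal) < τ}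

/-- Membership in `L^p_α((0, τ), E)`. -/
def MemWLp {E : Type*} [NormedAddCommGroup E] [NormedSpace ℂ E]
    (p : ℝ≥0∞) (α : ℝ) (τ : EReal) (f : ℝ → E) : Prop :=
  MemLp (fun t : ℝ => (t ^ α) • f t) p (volume.restrict (openTime τ))

/-- The norm of `L^p_α((0, τ), E)`. -/
def wLpNorm {E : Type*} [NormedAddCommGroup E] [NormedSpace ℂ E]
    (p : ℝ≥0∞) (α : ℝ) (τ : EReal) (f : ℝ → E) : ℝ≥0∞ :=
  eLpNorm (fun t : ℝ => (t ^ α) • f t) p (volume.restrict (openTime τ))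

/-! ### The convolutions and the three boundedness conditions -/

section Operators

variable {X Z W : Type*} [NormedAddCommGroup X] [NormedSpace ℂ X]
  [NormedAddCommGroup Z] [NormedSpace ℂ Z] [NormedAddCommGroup W] [NormedSpace ℂ W]

/-- The convolution `((T₋₁(·) B) ∗ u)(t) = ∫₀ᵗ T₋₁(t - s) B u(s) ds`, a Bochner integral
in `X₋₁`. -/
def convB (A : X →ₗ.[ℂ] X) (T : ℝ → X →L[ℂ] X) (B : W →L[ℂ] Extrap A) (u : ℝ → W) (t : ℝ) :
    Extrap A :=
  ∫ s in (0 : ℝ)..t, extrapSemigroup A T (t - s) (B (u s))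

/-- The kernel `C T₋₁(t) B`, for `t > 0`. (For such `t` the operator `T₋₁(t) B` maps into `D(A)`,
which is contained in `D(C)`.) -/
def kernelCB (A : X →ₗ.[ℂ] X) (T : ℝ → X →L[ℂ] X) (B : W →L[ℂ] Extrap A) (C : X →ₗ.[ℂ] Z)
    (t : ℝ) (w : W) : Z :=
  app C (toBase A (extrapSemigroup A T t (B w)))

/-- The convolution `((C T₋₁(·) B) ∗ u)(t) = ∫₀ᵗ C T₋₁(t - s) B u(s) ds`, a Bochner integral
in `Z`. -/
def convCB (A : X →ₗ.[ℂ] X) (T : ℝ → X →L[ℂ] X) (B : W →L[ℂ] Extrap A) (C : X →ₗ.[ℂ] Z)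
    (u : ℝ → W) (t : ℝ) : Z :=
  ∫ s in (0 : ℝ)..t, kernelCB A T B C (t - s) (u s)

/-- The map `x ↦ C T(·) x` is bounded `X → L^p_α((0, τ), Z)`. -/
def ConditionA1 (T : ℝ → X →L[ℂ] X) (C : X →ₗ.[ℂ] Z) (p : ℝ≥0∞) (α : ℝ) (τ : EReal) : Prop :=
  ∃ M : ℝ≥0, ∀ x : X, MemWLp p α τ (fun t => app C (T t x)) ∧
    wLpNorm p α τ (fun t => app C (T t x)) ≤ M * ‖x‖ₑ

/-- The map `(T₋₁(·) B) ∗` is bounded `L^{p/2}_{2α}((0, τ), W) → L^∞((0, τ), X)`: the convolution,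
which is defined in `X₋₁`, takes values in `X` almost everywhere. -/
def ConditionA2 (A : X →ₗ.[ℂ] X) (T : ℝ → X →L[ℂ] X) (B : W →L[ℂ] Extrap A)
    (p : ℝ≥0∞) (α : ℝ) (τ : EReal) : Prop :=
  ∃ M : ℝ≥0, ∀ u : ℝ → W, MemWLp (p / 2) (2 * α) τ u →
    ∃ v : ℝ → X, MemLp v ∞ (volume.restrict (openTime τ)) ∧
      (∀ᵐ t ∂(volume.restrict (openTime τ)), embed A (v t) = convB A T B u t) ∧
      eLpNorm v ∞ (volume.restrict (openTime τ)) ≤ M * wLpNorm (p / 2) (2 * α) τ u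

/-- The map `(C T₋₁(·) B) ∗` is (well-defined and) bounded
`L^{p/2}_{2α}((0, τ), W) → L^p_α((0, τ), Z)`. -/
def ConditionA3 (A : X →ₗ.[ℂ] X) (T : ℝ → X →L[ℂ] X) (B : W →L[ℂ] Extrap A) (C : X →ₗ.[ℂ] Z)
    (p : ℝ≥0∞) (α : ℝ) (τ : EReal) : Prop :=
  ∃ M : ℝ≥0, ∀ u : ℝ → W, MemWLp (p / 2) (2 * α) τ u →
    (∀ᵐ t ∂(volume.restrict (openTime τ)),
      IntervalIntegrable (fun s => kernelCB A T B C (t - s) (u s)) volume 0 t) ∧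
    MemWLp p α τ (convCB A T B C u) ∧
    wLpNorm p α τ (convCB A T B C u) ≤ M * wLpNorm (p / 2) (2 * α) τ u

/-- `x` is a mild solution on `[0, η)` of
`x' + A x = B F(C x, C x)`, `x(0) = x₀`, in the class of all `x ∈ C([0, η), X♭)` with
`C x ∈ L^p_α((0, η), Z)`, where `X♭` is the closure of `D(A)` in `X`. The integral equation
`x(t) = T(t) x₀ + ∫₀ᵗ T₋₁(t - s) B F(C x(s), C x(s)) ds` is read in `X₋₁`, where the integral is
defined. Values of `x` outside `[0, η)` are irrelevant. -/
structure IsMildSolution (A : X →ₗ.[ℂ] X) (T : ℝ → X →L[ℂ] X) (B : W →L[ℂ] Extrap A)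
    (C : X →ₗ.[ℂ] Z) (F : Z →L[ℂ] Z →L[ℂ] W) (p : ℝ≥0∞) (α : ℝ) (x₀ : X) (η : EReal)
    (x : ℝ → X) : Prop where
  continuousOn : ContinuousOn x (halfOpenTime η)
  mem_closure : ∀ t ∈ halfOpenTime η, x t ∈ closure (A.domain : Set X)
  mem_domain : ∀ᵐ t ∂(volume.restrict (openTime η)), x t ∈ C.domain
  memWLp : MemWLp p α η (fun t => app C (x t))
  integral_eq : ∀ t ∈ halfOpenTime η,
    embed A (x t) = embed A (T t x₀) + convB A T B (fun s => F (app C (x s)) (app C (x s))) t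

end Operators

end

end AbstractKato

/-! ### Bounded analytic semigroups without density of the domain. -/

namespace AbstractKato

open Filter Topology

/-! Kato's method solves first for `y = Cx` and then recovers `x`. By Hölder, `F` maps a pair from
`L^p_α` into `L^{p/2}_{2α}`, since weights and reciprocal exponents add, and [A3] leads back to
`L^p_α`. Hence `y = CT(·)x₀ + (CT₋₁(·)B) * F(y, y)` is a quadratic fixed point equation, solvable by
contraction when `CT(·)x₀` is small (`exists_quadratic_fixedPoint`). Smallness comes from [A1] if
`x₀` is small, and otherwise from a short interval: on the closure of `D(A)` the norm of `CT(·)x₀`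
over `(0, h)` tends to `0` because `α + 1/p > 0` (`tendsto_wLpNorm_orbit`).

To recover `x` one needs `v = (T₋₁(·)B) * u` continuous with values in `X♭`, whereas [A2] only gives
essential boundedness. Testing [A2] on constants yields `‖(I+A)T(t)(I+A₋₁)⁻¹B‖ ≤ c t^(2α+2/p-1)`
near `0`, an integrable singularity (`exists_shiftedSemigroup_baseMap_le`). So `v` is continuous for
bounded `u`; a general `u` is approximated by bounded functions, and [A2] makes the corresponding
`v` converge uniformly (`exists_continuousOn_eq_convB`). Letting `δ → 0` in `CT(δ)v(t-δ)`,
closedness of `C` gives `Cv = (CT₋₁(·)B) * u` (`mem_domain_and_app_eq_convCB`).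

For uniqueness, the difference of two solutions is bounded by itself times a multiple of the norms
of `Cx` and `Cy` on `(0, h)`, so these norms must vanish as `h → 0`. For `p < ∞` this is absolute
continuity of the integral. For `p = ∞` it is forced by continuity of the solution at `0`
(`tendsto_wLpNorm_convCB_of_top`). Local uniqueness then propagates by restarting solutions at later
times.

As `A` need not be densely defined, identities in `X₋₁` are pulled back to `X` and checked after
applying the injective operator `(I+A)⁻¹`. -/

lemma isOpen_sector {θ : ℝ} (hθ : θ ≤ Real.pi / 2) : IsOpen (sector θ) := by
  -- `Complex.arg` is continuous only off the negative real axis; `θ ≤ π/2` keeps the sector away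
  -- from it.
  have h : sector θ = Complex.slitPlane ∩ (fun z : ℂ => |z.arg|) ⁻¹' (Iio θ) := by
    ext z
    simp only [sector, mem_ofPred_eq, mem_inter_iff, Complex.mem_slitPlane_iff_arg, mem_preimage,
      mem_Iio]
    refine ⟨fun h => ⟨⟨fun h' => ?_, h.1⟩, h.2⟩, fun h => ⟨h.1.2, h.2⟩⟩
    have h2 := h.2
    rw [h', abs_of_pos Real.pi_pos] at h2
    linarith [Real.pi_pos]
  rw [h]
  refine ContinuousOn.isOpen_inter_preimage (fun z hz => ?_) Complex.isOpen_slitPlane isOpen_Iio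
  exact ((Complex.continuousAt_arg hz).abs).continuousWithinAt

lemma ofReal_mem_sector {θ t : ℝ} (hθ : 0 < θ) (ht : 0 < t) : (t : ℂ) ∈ sector θ := by
  refine ⟨by exact_mod_cast ht.ne', ?_⟩
  rw [Complex.arg_ofReal_of_nonneg ht.le]
  simpa using hθ

/-- A sector is invariant under positive dilations, so a ball about `1` can be scaled to every `t`.
Radii proportional to `t` are what the Cauchy estimate for `T'` needs. -/
lemma exists_closedBall_subset_sector {θ : ℝ} (hθ : 0 < θ) (hθ' : θ ≤ Real.pi / 2) :
    ∃ ρ : ℝ, 0 < ρ ∧ ∀ t : ℝ, 0 < t → Metric.closedBall (t : ℂ) (ρ * t) ⊆ sector θ := by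
  have h1 : sector θ ∈ 𝓝 (1 : ℂ) :=
    (isOpen_sector hθ').mem_nhds (by simpa using ofReal_mem_sector hθ one_pos)
  obtain ⟨ρ, hρ, hsub⟩ := Metric.nhds_basis_closedBall.mem_iff.1 h1
  refine ⟨ρ, hρ, fun t ht z hz => ?_⟩
  have htc : (t : ℂ) ≠ 0 := by exact_mod_cast ht.ne'
  have hz' : z / t ∈ sector θ := by
    apply hsub
    rw [mem_closedBall_iff_norm] at hz ⊢
    have : z / t - 1 = (z - t) / t := by field_simp
    rw [this, norm_div, Complex.norm_real, Real.norm_of_nonneg ht.le, div_le_iff₀ ht]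
    exact hz
  have hzt : z = (t : ℂ) * (z / t) := by field_simp
  rw [hzt]
  refine ⟨mul_ne_zero htc hz'.1, ?_⟩
  rw [Complex.arg_real_mul _ ht]
  exact hz'.2

noncomputable section

variable {X : Type*} [NormedAddCommGroup X] [NormedSpace ℂ X]
  {A : X →ₗ.[ℂ] X} {T : ℝ → X →L[ℂ] X}

/-- The operator `(I + A) T(t)`, for `t > 0`. -/
def shiftedSemigroup (T : ℝ → X →L[ℂ] X) (t : ℝ) : X →L[ℂ] X := T t - deriv T t

lemma app_of_mem {E G : Type*} [AddCommGroup E] [Module ℂ E] [AddCommGroup G] [Module ℂ G]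
    {C : E →ₗ.[ℂ] G} {x : E} (h : x ∈ C.domain) : app C x = C ⟨x, h⟩ := dif_pos h

lemma app_add {E G : Type*} [AddCommGroup E] [Module ℂ E] [AddCommGroup G] [Module ℂ G]
    {C : E →ₗ.[ℂ] G} {x y : E} (hx : x ∈ C.domain) (hy : y ∈ C.domain) :
    app C (x + y) = app C x + app C y := by
  rw [app_of_mem hx, app_of_mem hy, app_of_mem (C.domain.add_mem hx hy), ← C.map_add]
  rfl

lemma IsInverseOfShift.injective {μ : ℂ} {R : X →L[ℂ] X} (h : IsInverseOfShift A μ R) :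
    Function.Injective R := by
  intro x y hxy
  rw [← (h.1 x).2, ← (h.1 y).2, hxy]

lemma IsInverseOfShift.exists_eq {μ : ℂ} {R : X →L[ℂ] X} (h : IsInverseOfShift A μ R) {x : X}
    (hx : x ∈ A.domain) : ∃ y, R y = x := ⟨_, h.2 ⟨x, hx⟩⟩

lemma IsInverseOfShift.unique {μ : ℂ} {R R' : X →L[ℂ] X} (h : IsInverseOfShift A μ R)
    (h' : IsInverseOfShift A μ R') : R = R' := by
  ext x
  have h1 := h'.2 ⟨R x, (h.1 x).1⟩
  have h2 := (h.1 x).2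
  rw [app_of_mem (h.1 x).1] at h2
  exact h1.symm.trans (congrArg R' h2)

namespace GeneratesBoundedAnalyticSemigroup

variable (hT : GeneratesBoundedAnalyticSemigroup A T)
include hT

lemma isInverseOfShift : IsInverseOfShift A 1 (shiftInv A) := by
  have h : ∃ R : X →L[ℂ] X, IsInverseOfShift A 1 R := by
    obtain ⟨R, hR, -⟩ := hT.generator 1 one_pos
    exact ⟨R, by simpa using hR⟩
  rw [shiftInv, dif_pos h]
  exact h.choose_spec

lemma shiftInv_eq_integral (x : X) :
    shiftInv A x = ∫ t in Ioi (0 : ℝ), Real.exp (-t) • T t x := by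
  obtain ⟨R, hR, hRint⟩ := hT.generator 1 one_pos
  have : shiftInv A = R := hT.isInverseOfShift.unique (by simpa using hR)
  rw [this, hRint]
  simp

lemma exists_norm_le : ∃ M : ℝ, 0 < M ∧ ∀ t : ℝ, 0 ≤ t → ‖T t‖ ≤ M := by
  obtain ⟨θ, hθ, -, S, -, ⟨M, hM⟩, hS⟩ := hT.analytic
  refine ⟨max M 1, by positivity, fun t ht => ?_⟩
  rcases ht.eq_or_lt with rfl | ht
  · rw [hT.map_zero]
    exact ContinuousLinearMap.norm_id_le.trans (le_max_right _ _)
  · rw [← hS t ht]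
    exact (hM _ (ofReal_mem_sector hθ ht)).trans (le_max_left _ _)

/-- Cauchy's estimate for the holomorphic extension on a circle of radius `ρ t` about `t` gives the
bound `(M / ρ) / t`. -/
lemma hasDerivAt_and_continuousOn_deriv [CompleteSpace X] :
    (∃ K : ℝ, 0 ≤ K ∧ ∀ t : ℝ, 0 < t → HasDerivAt T (deriv T t) t ∧ ‖deriv T t‖ ≤ K / t) ∧
      ContinuousOn (deriv T) (Ioi 0) := by
  obtain ⟨θ, hθ, hθ', S, hSd, ⟨M, hM⟩, hS⟩ := hT.analytic
  have hopen := isOpen_sector hθ'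
  have hderiv : ∀ t : ℝ, 0 < t → HasDerivAt T (deriv S t) t := by
    intro t ht
    have h1 : HasDerivAt S (deriv S t) (t : ℂ) :=
      (hSd.differentiableAt (hopen.mem_nhds (ofReal_mem_sector hθ ht))).hasDerivAt
    have h2 := HasDerivAt.scomp (h := fun s : ℝ => (s : ℂ)) t h1
      (Complex.ofRealCLM.hasDerivAt (x := t))
    simp only [Complex.ofRealCLM_apply, Complex.ofReal_one, one_smul] at h2
    refine h2.congr_of_eventuallyEq ?_
    filter_upwards [lt_mem_nhds ht] with s hs using (hS s hs).symm
  have heq : ∀ t : ℝ, 0 < t → deriv T t = deriv S t := fun t ht => (hderiv t ht).deriv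
  obtain ⟨ρ, hρ, hball⟩ := exists_closedBall_subset_sector hθ hθ'
  have hM0 : 0 ≤ M := (norm_nonneg _).trans (hM _ (ofReal_mem_sector hθ one_pos))
  refine ⟨⟨M / ρ, by positivity, fun t ht => ⟨(heq t ht).symm ▸ hderiv t ht, ?_⟩⟩, ?_⟩
  · rw [heq t ht, div_div]
    refine Complex.norm_deriv_le_of_forall_mem_sphere_norm_le (by positivity) ?_
      fun z hz => hM z (hball t ht (Metric.sphere_subset_closedBall hz))
    refine DifferentiableOn.diffContOnCl (hSd.mono ?_)
    rw [closure_ball _ (by positivity)]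
    exact hball t ht
  · have h3 : ContinuousOn (fun t : ℝ => deriv S t) (Ioi 0) :=
      ((hSd.deriv hopen).continuousOn).comp Complex.continuous_ofReal.continuousOn
        fun t ht => ofReal_mem_sector hθ ht
    exact h3.congr fun t ht => heq t ht

lemma continuousOn : ContinuousOn T (Ioi 0) := by
  obtain ⟨θ, hθ, hθ', S, hSd, -, hS⟩ := hT.analytic
  have h3 : ContinuousOn (fun t : ℝ => S t) (Ioi 0) :=
    hSd.continuousOn.comp Complex.continuous_ofReal.continuousOn
      fun t ht => ofReal_mem_sector hθ ht
  exact h3.congr fun t ht => (hS t ht).symm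

lemma map_add_apply {s t : ℝ} (hs : 0 ≤ s) (ht : 0 ≤ t) (x : X) : T (s + t) x = T s (T t x) := by
  rcases hs.eq_or_lt with rfl | hs
  · simp [hT.map_zero]
  rcases ht.eq_or_lt with rfl | ht
  · simp [hT.map_zero]
  rw [hT.map_add s t hs ht]; rfl

lemma integrableOn_exp_smul {t : ℝ} (ht : 0 ≤ t) (x : X) :
    IntegrableOn (fun s => Real.exp (-s) • T s x) (Ioi t) := by
  obtain ⟨M, hM, hTM⟩ := hT.exists_norm_le
  have h1 : IntegrableOn (fun s => Real.exp (-s) * (M * ‖x‖)) (Ioi t) :=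
    (integrableOn_exp_neg_Ioi t).mul_const _
  have hc : ContinuousOn (fun s => Real.exp (-s) • T s x) (Ioi t) := by
    refine ContinuousOn.smul (f := fun s => Real.exp (-s)) (by fun_prop) ?_
    exact (hT.continuousOn.mono (Ioi_subset_Ioi ht)).clm_apply continuousOn_const
  refine Integrable.mono' h1 (hc.aestronglyMeasurable measurableSet_Ioi) ?_
  filter_upwards [ae_restrict_mem measurableSet_Ioi] with s hs
  rw [norm_smul, Real.norm_of_nonneg (Real.exp_pos _).le]
  gcongr
  exact (T s).le_of_opNorm_le (hTM s (ht.trans (le_of_lt hs))) x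

variable [CompleteSpace X]

/-- The semigroup law moves `T t` inside the Laplace integral, and a translation of the variable
turns the result into a tail. All regularity in `t` of `T t (shiftInv A x)` is read off from this
formula. -/
lemma map_shiftInv_eq_integral {t : ℝ} (ht : 0 ≤ t) (x : X) :
    T t (shiftInv A x) = Real.exp t • ∫ s in Ioi t, Real.exp (-s) • T s x := by
  rw [hT.shiftInv_eq_integral, ← ContinuousLinearMap.integral_comp_comm _
    (hT.integrableOn_exp_smul le_rfl x)]
  have h1 : ∀ s ∈ Ioi (0 : ℝ), T t (Real.exp (-s) • T s x) =
      Real.exp t • (Real.exp (-(s + t)) • T (s + t) x) := by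
    intro s hs
    rw [ContinuousLinearMap.map_smul_of_tower, add_comm s t, hT.map_add_apply ht (le_of_lt hs),
      smul_smul,
      ← Real.exp_add]
    congr 2
    ring
  rw [setIntegral_congr_fun measurableSet_Ioi h1, integral_smul]
  congr 1
  have := (measurePreserving_add_right volume t).setIntegral_preimage_emb
    (measurableEmbedding_addRight t) (fun s => Real.exp (-s) • T s x) (Ioi t)
  rw [← this]
  congr 1
  simp

lemma shiftInv_map (t : ℝ) (ht : 0 ≤ t) (x : X) : shiftInv A (T t x) = T t (shiftInv A x) := by
  rcases ht.eq_or_lt with rfl | ht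
  · simp [hT.map_zero]
  rw [hT.shiftInv_eq_integral, hT.shiftInv_eq_integral, ← ContinuousLinearMap.integral_comp_comm _
    (hT.integrableOn_exp_smul le_rfl x)]
  refine setIntegral_congr_fun measurableSet_Ioi fun s hs => ?_
  rw [ContinuousLinearMap.map_smul_of_tower, ← hT.map_add_apply ht.le (le_of_lt hs),
    ← hT.map_add_apply (le_of_lt hs) ht.le, add_comm]

omit [CompleteSpace X] in
lemma shiftInv_injective : Function.Injective (shiftInv A) := hT.isInverseOfShift.injective

lemma hasDerivAt {t : ℝ} (ht : 0 < t) : HasDerivAt T (deriv T t) t := by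
  obtain ⟨K, -, hK⟩ := hT.hasDerivAt_and_continuousOn_deriv.1
  exact (hK t ht).1

lemma hasDerivAt_apply {t : ℝ} (ht : 0 < t) (x : X) :
    HasDerivAt (fun s => T s x) (deriv T t x) t :=
  ((ContinuousLinearMap.apply ℝ X x).hasFDerivAt.comp_hasDerivAt t
    ((ContinuousLinearMap.restrictScalarsL ℂ X X ℝ ℝ).hasFDerivAt.comp_hasDerivAt t
      (hT.hasDerivAt ht)))

/-- This is `T'(t) = -A T(t)` with `A` removed by applying `(I+A)⁻¹`: both sides are the derivative
of `(I+A)⁻¹T(t)x`, once through `T` and once through the tail formula. -/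
lemma deriv_apply_shiftInv {t : ℝ} (ht : 0 < t) (x : X) :
    shiftInv A (deriv T t x) = shiftInv A (T t x) - T t x := by
  set f : ℝ → X := fun s => Real.exp (-s) • T s x with hf
  have hfi : IntegrableOn f (Ioi 0) := hT.integrableOn_exp_smul le_rfl x
  have hfc : ContinuousOn f (Ioi 0) :=
    ContinuousOn.smul (f := fun s => Real.exp (-s)) (by fun_prop)
      (hT.continuousOn.clm_apply continuousOn_const)
  have hIt : IntervalIntegrable f volume 0 t :=
    (intervalIntegrable_iff_integrableOn_Ioc_of_le ht.le).2 (hfi.mono_set Ioc_subset_Ioi_self)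
  have h1 : HasDerivAt (fun u => ∫ s in (0 : ℝ)..u, f s) (f t) t :=
    intervalIntegral.integral_hasDerivAt_right hIt
      (hfc.stronglyMeasurableAtFilter isOpen_Ioi t ht) (hfc.continuousAt (Ioi_mem_nhds ht))
  have h2 : HasDerivAt (fun u => Real.exp u • ((∫ s in Ioi (0 : ℝ), f s) - ∫ s in (0 : ℝ)..u, f s))
      (Real.exp t • (0 - f t) +
        Real.exp t • ((∫ s in Ioi (0 : ℝ), f s) - ∫ s in (0 : ℝ)..t, f s)) t :=
    (Real.hasDerivAt_exp t).smul ((hasDerivAt_const t _).sub h1)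
  have h3 : ∀ u : ℝ, 0 < u → shiftInv A (T u x) =
      Real.exp u • ((∫ s in Ioi (0 : ℝ), f s) - ∫ s in (0 : ℝ)..u, f s) := by
    intro u hu
    rw [hT.shiftInv_map u hu.le, hT.map_shiftInv_eq_integral hu.le,
      ← intervalIntegral.integral_Ioi_sub_Ioi hfi hu.le, sub_sub_cancel]
  have h4 : HasDerivAt (fun u => shiftInv A (T u x)) (shiftInv A (deriv T t x)) t :=
    ((shiftInv A).restrictScalars ℝ).hasFDerivAt.comp_hasDerivAt t (hT.hasDerivAt_apply ht x)
  have h5 := h4.unique (h2.congr_of_eventuallyEq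
    (by filter_upwards [lt_mem_nhds ht] with u hu using h3 u hu))
  rw [h5, ← h3 t ht, hf, zero_sub, smul_neg, smul_smul, ← Real.exp_add, add_neg_cancel,
    Real.exp_zero, one_smul, neg_add_eq_sub]

/-- This justifies reading `T(t) - T'(t)` as `(I+A)T(t)`. Together with injectivity of `(I+A)⁻¹` it
is the device by which the later operator identities are verified. -/
lemma shiftInv_shiftedSemigroup {t : ℝ} (ht : 0 < t) (x : X) :
    shiftInv A (shiftedSemigroup T t x) = T t x := by
  rw [shiftedSemigroup, sub_apply, map_sub, hT.deriv_apply_shiftInv ht,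
    sub_sub_cancel]

omit [CompleteSpace X] in
lemma shiftInv_mem_domain (x : X) : shiftInv A x ∈ A.domain := (hT.isInverseOfShift.1 x).1

lemma map_mem_domain {t : ℝ} (ht : 0 < t) (x : X) : T t x ∈ A.domain := by
  rw [← hT.shiftInv_shiftedSemigroup ht]
  exact hT.shiftInv_mem_domain _

lemma shiftedSemigroup_shiftInv {t : ℝ} (ht : 0 < t) (x : X) :
    shiftedSemigroup T t (shiftInv A x) = T t x := by
  apply hT.shiftInv_injective
  rw [hT.shiftInv_shiftedSemigroup ht, hT.shiftInv_map t ht.le]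

lemma shiftedSemigroup_add {s t : ℝ} (hs : 0 ≤ s) (ht : 0 < t) (x : X) :
    shiftedSemigroup T (s + t) x = T s (shiftedSemigroup T t x) := by
  apply hT.shiftInv_injective
  rw [hT.shiftInv_shiftedSemigroup (by positivity), hT.shiftInv_map s hs,
    hT.shiftInv_shiftedSemigroup ht, hT.map_add_apply hs ht.le]

lemma shiftedSemigroup_mem_domain {t : ℝ} (ht : 0 < t) (x : X) :
    shiftedSemigroup T t x ∈ A.domain := by
  rw [← add_halves t, hT.shiftedSemigroup_add (by positivity) (by positivity)]
  exact hT.map_mem_domain (by positivity) _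

lemma continuousOn_shiftedSemigroup : ContinuousOn (shiftedSemigroup T) (Ioi 0) :=
  hT.continuousOn.sub hT.hasDerivAt_and_continuousOn_deriv.2

lemma exists_norm_shiftedSemigroup_le : ∃ M K : ℝ, 0 ≤ M ∧ 0 ≤ K ∧
    ∀ t : ℝ, 0 < t → ‖shiftedSemigroup T t‖ ≤ M + K / t := by
  obtain ⟨M, hM, hTM⟩ := hT.exists_norm_le
  obtain ⟨⟨K, hK, h⟩, -⟩ := hT.hasDerivAt_and_continuousOn_deriv
  exact ⟨M, K, hM.le, hK, fun t ht =>
    (norm_sub_le _ _).trans (add_le_add (hTM t ht.le) (h t ht).2)⟩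

/-- Strong continuity at `0` on the closure of the domain. -/
lemma tendsto_nhdsWithin_zero {x : X} (hx : x ∈ closure (A.domain : Set X)) :
    Tendsto (fun t => T t x) (𝓝[≥] 0) (𝓝 x) := by
  obtain ⟨M, hM, hTM⟩ := hT.exists_norm_le
  rw [Metric.tendsto_nhds]
  intro ε hε
  obtain ⟨z, hz, hxz⟩ := Metric.mem_closure_iff.1 hx (ε / (2 * (M + 1))) (by positivity)
  obtain ⟨y, rfl⟩ := hT.isInverseOfShift.exists_eq hz
  -- On the domain the tail formula gives convergence, since the primitive of an integrable function
  -- vanishes at `0`; uniform boundedness of `T` then carries it to the closure.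
  have h1 : Tendsto (fun t => T t (shiftInv A y)) (𝓝[≥] 0) (𝓝 (shiftInv A y)) := by
    set f : ℝ → X := fun s => Real.exp (-s) • T s y
    have hfi : IntegrableOn f (Ioi 0) := hT.integrableOn_exp_smul le_rfl y
    have hR : shiftInv A y = ∫ s in Ioi (0 : ℝ), f s := hT.shiftInv_eq_integral y
    have h2 : ContinuousOn (fun u => ∫ s in (0 : ℝ)..u, f s) (Icc 0 1) := by
      have := intervalIntegral.continuousOn_primitive_interval (μ := volume) (f := f) (a := 0)
        (b := 1) (by
          rw [uIcc_of_le zero_le_one, integrableOn_Icc_iff_integrableOn_Ioc]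
          exact hfi.mono_set Ioc_subset_Ioi_self)
      rwa [uIcc_of_le zero_le_one] at this
    have h3 : Tendsto (fun u => ∫ s in (0 : ℝ)..u, f s) (𝓝[≥] 0) (𝓝 0) := by
      have := h2 0 (by simp)
      rw [ContinuousWithinAt, nhdsWithin_Icc_eq_nhdsGE zero_lt_one,
        intervalIntegral.integral_same] at this
      exact this
    have h4 : Tendsto (fun u => Real.exp u • (shiftInv A y - ∫ s in (0 : ℝ)..u, f s)) (𝓝[≥] 0)
        (𝓝 (Real.exp 0 • (shiftInv A y - 0))) :=
      ((Real.continuous_exp.tendsto 0).mono_left nhdsWithin_le_nhds).smul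
        (tendsto_const_nhds.sub h3)
    rw [Real.exp_zero, one_smul, sub_zero] at h4
    refine h4.congr' ?_
    filter_upwards [self_mem_nhdsWithin] with u hu
    rw [hT.map_shiftInv_eq_integral hu, hR, ← intervalIntegral.integral_Ioi_sub_Ioi hfi hu,
      sub_sub_cancel]
  have h5 := (Metric.tendsto_nhds.1 h1) (ε / 2) (by positivity)
  filter_upwards [h5, self_mem_nhdsWithin] with t ht ht0
  rw [dist_eq_norm] at ht hxz ⊢
  set z := shiftInv A y
  have h6 : T t x - x = T t (x - z) + (T t z - z) - (x - z) := by
    rw [map_sub]; abel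
  have h7 : ‖T t (x - z)‖ ≤ M * ‖x - z‖ := (T t).le_of_opNorm_le (hTM t ht0) _
  rw [lt_div_iff₀ (by positivity)] at hxz
  calc ‖T t x - x‖ ≤ ‖T t (x - z)‖ + ‖T t z - z‖ + ‖x - z‖ := by
        rw [h6]; exact (norm_sub_le _ _).trans (add_le_add_left (norm_add_le _ _) _)
    _ ≤ M * ‖x - z‖ + ‖T t z - z‖ + ‖x - z‖ := by gcongr
    _ < ε := by linarith

lemma continuousOn_apply {x : X} (hx : x ∈ closure (A.domain : Set X)) :
    ContinuousOn (fun t => T t x) (Ici 0) := by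
  intro t ht
  rcases (mem_Ici.1 ht).eq_or_lt with rfl | ht
  · have := hT.tendsto_nhdsWithin_zero hx
    rw [ContinuousWithinAt, hT.map_zero]
    exact this
  · exact ((hT.hasDerivAt_apply ht x).continuousAt).continuousWithinAt

lemma map_mem_closure {x : X} (hx : x ∈ closure (A.domain : Set X)) {t : ℝ} (ht : 0 ≤ t) :
    T t x ∈ closure (A.domain : Set X) := by
  rcases ht.eq_or_lt with rfl | ht
  · simpa [hT.map_zero] using hx
  · exact subset_closure (hT.map_mem_domain ht x)

end GeneratesBoundedAnalyticSemigroup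

end

end AbstractKato

namespace AbstractKato

open Filter Topology

noncomputable section

/-! ### The extrapolation space and the kernels expressed inside `X`. -/

section Extrapolation

variable {X Z W : Type*} [NormedAddCommGroup X] [NormedSpace ℂ X]
  [NormedAddCommGroup Z] [NormedSpace ℂ Z] [NormedAddCommGroup W] [NormedSpace ℂ W]
  {A : X →ₗ.[ℂ] X} {T : ℝ → X →L[ℂ] X} {C : X →ₗ.[ℂ] Z}

/-- The operator `(I + A₋₁)⁻¹ B : W → X`. -/
def baseMap (A : X →ₗ.[ℂ] X) (B : W →L[ℂ] Extrap A) : W →L[ℂ] X :=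
  ((shiftIso A).symm.toContinuousLinearEquiv : Extrap A →L[ℂ] X).comp B

lemma embed_apply (x : X) : embed A x = shiftIso A (shiftInv A x) := rfl

lemma convB_eq (B : W →L[ℂ] Extrap A) (u : ℝ → W) (t : ℝ) :
    convB A T B u t = shiftIso A (∫ s in (0 : ℝ)..t, T (t - s) (baseMap A B (u s))) := rfl

/-- Removing the isometry `I + A₋₁` turns an equation in `X₋₁` into one in `X` in which only the
bounded operators `T(t)` occur. -/
lemma embed_eq_convB_iff {B : W →L[ℂ] Extrap A} {u : ℝ → W} {t : ℝ} {x : X} :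
    embed A x = convB A T B u t ↔
      shiftInv A x = ∫ s in (0 : ℝ)..t, T (t - s) (baseMap A B (u s)) := by
  rw [embed_apply, convB_eq, (shiftIso A).injective.eq_iff]

/-- Relative boundedness makes `C(I+A)⁻¹` a bounded operator. It replaces `C` wherever `C` has to
pass through a Bochner integral. -/
lemma exists_comp_shiftInv (hT : GeneratesBoundedAnalyticSemigroup A T)
    (hdom : A.domain ≤ C.domain)
    (hbdd : ∃ c : ℝ, ∀ x : A.domain, ‖app C x‖ ≤ c * ‖(x : X) + A x‖) :
    ∃ L : X →L[ℂ] Z, ∀ x, L x = app C (shiftInv A x) := by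
  obtain ⟨c, hc⟩ := hbdd
  have hmem : ∀ x, shiftInv A x ∈ C.domain := fun x => hdom (hT.shiftInv_mem_domain x)
  let L₀ : X →ₗ[ℂ] Z :=
    C.toFun.comp ((shiftInv A : X →ₗ[ℂ] X).codRestrict C.domain hmem)
  have hL₀ : ∀ x, L₀ x = app C (shiftInv A x) := fun x => (app_of_mem (hmem x)).symm
  refine ⟨L₀.mkContinuous c fun x => ?_, hL₀⟩
  rw [hL₀]
  have h1 := hc ⟨_, hT.shiftInv_mem_domain x⟩
  have h2 := (hT.isInverseOfShift.1 x).2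
  rw [app_of_mem (hT.shiftInv_mem_domain x), one_smul] at h2
  exact h1.trans_eq (congrArg (fun y => c * ‖y‖) h2)

lemma embed_injective (hT : GeneratesBoundedAnalyticSemigroup A T) :
    Function.Injective (embed A) := fun _ _ h =>
  hT.shiftInv_injective ((shiftIso A).injective h)

variable [CompleteSpace X]

lemma app_semigroup (hT : GeneratesBoundedAnalyticSemigroup A T) {L : X →L[ℂ] Z}
    (hL : ∀ x, L x = app C (shiftInv A x)) {t : ℝ} (ht : 0 < t) (x : X) :
    app C (T t x) = L (shiftedSemigroup T t x) := by
  rw [hL, hT.shiftInv_shiftedSemigroup ht]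

/-- The operator `(I + A)² T(t)`, for `t > 0`. -/
def shiftedSemigroupSq (T : ℝ → X →L[ℂ] X) (t : ℝ) : X →L[ℂ] X :=
  (shiftedSemigroup T (t / 2)).comp (shiftedSemigroup T (t / 2))

lemma shiftInv_shiftedSemigroupSq (hT : GeneratesBoundedAnalyticSemigroup A T) {t : ℝ}
    (ht : 0 < t) (x : X) : shiftInv A (shiftedSemigroupSq T t x) = shiftedSemigroup T t x := by
  rw [shiftedSemigroupSq, ContinuousLinearMap.comp_apply,
    hT.shiftInv_shiftedSemigroup (by positivity),
    ← hT.shiftedSemigroup_add (by positivity) (by positivity), add_halves]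

lemma shiftedSemigroupSq_add (hT : GeneratesBoundedAnalyticSemigroup A T) {s t : ℝ}
    (hs : 0 < s) (ht : 0 < t) (x : X) :
    shiftedSemigroupSq T (s + t) x = shiftedSemigroup T s (shiftedSemigroup T t x) := by
  apply hT.shiftInv_injective
  rw [shiftInv_shiftedSemigroupSq hT (by positivity), hT.shiftInv_shiftedSemigroup hs,
    hT.shiftedSemigroup_add hs.le ht]

lemma shiftedSemigroupSq_map (hT : GeneratesBoundedAnalyticSemigroup A T) {s t : ℝ}
    (hs : 0 < s) (ht : 0 < t) (x : X) :
    shiftedSemigroupSq T s (T t x) = shiftedSemigroupSq T (s + t) x := by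
  rw [shiftedSemigroupSq_add hT hs ht, ← hT.shiftedSemigroup_shiftInv ht]
  nth_rewrite 1 [← add_halves s]
  rw [shiftedSemigroupSq_add hT (by positivity) (by positivity)]
  apply hT.shiftInv_injective
  rw [hT.shiftInv_shiftedSemigroup (by positivity), hT.shiftInv_shiftedSemigroup (by positivity),
    ← hT.shiftedSemigroup_add (by positivity) (by positivity), add_halves]
  apply hT.shiftInv_injective
  rw [hT.shiftInv_shiftedSemigroup hs, hT.shiftedSemigroup_shiftInv ht,
    ← hT.map_add_apply hs.le ht.le, hT.shiftInv_map s hs.le, hT.shiftInv_shiftedSemigroup ht,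
    hT.map_add_apply hs.le ht.le]

/-- Since `T₋₁(t)Bw` is the embedded vector `(I+A)T(t)(I+A₋₁)⁻¹Bw`, injectivity of the embedding
lets `toBase` recover it. For `t > 0` the kernel is thereby a bounded operator, in particular linear
in `w`. -/
lemma kernelCB_eq (hT : GeneratesBoundedAnalyticSemigroup A T) {L : X →L[ℂ] Z}
    (hL : ∀ x, L x = app C (shiftInv A x)) (B : W →L[ℂ] Extrap A) {t : ℝ} (ht : 0 < t) (w : W) :
    kernelCB A T B C t w = L (shiftedSemigroupSq T t (baseMap A B w)) := by
  have h1 : extrapSemigroup A T t (B w) = embed A (shiftedSemigroup T t (baseMap A B w)) := by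
    rw [embed_apply, hT.shiftInv_shiftedSemigroup ht]; rfl
  rw [kernelCB, h1, toBase, Function.leftInverse_invFun (embed_injective hT), hL,
    shiftInv_shiftedSemigroupSq hT ht]

end Extrapolation

/-! ### Weighted Lebesgue spaces. -/

section FunctionSpaces

variable {E : Type*} [NormedAddCommGroup E] [NormedSpace ℂ E] {p : ℝ≥0∞} {α : ℝ} {η τ : EReal}
  {f g : ℝ → E}

lemma measurableSet_openTime (τ : EReal) : MeasurableSet (openTime τ) :=
  ((isOpen_lt continuous_const continuous_id).inter
    (isOpen_lt continuous_coe_real_ereal continuous_const)).measurableSet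

lemma openTime_mono (h : η ≤ τ) : openTime η ⊆ openTime τ := fun _ ht => ⟨ht.1, ht.2.trans_le h⟩

lemma ae_openTime (τ : EReal) : ∀ᵐ t ∂(volume.restrict (openTime τ)), t ∈ openTime τ :=
  ae_restrict_mem (measurableSet_openTime τ)

lemma ae_openTime_mono (h : η ≤ τ) {P : ℝ → Prop}
    (hP : ∀ᵐ t ∂(volume.restrict (openTime τ)), P t) :
    ∀ᵐ t ∂(volume.restrict (openTime η)), P t :=
  ae_restrict_of_ae_restrict_of_subset (openTime_mono h) hP

lemma Ioc_subset_openTime {t : ℝ} (ht : (t : EReal) < η) : Ioc 0 t ⊆ openTime η := fun s hs =>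
  ⟨hs.1, lt_of_le_of_lt (by exact_mod_cast hs.2) ht⟩

lemma openTime_coe (h : ℝ) : openTime (h : EReal) = Ioo 0 h := by
  ext t; simp [openTime]

lemma exists_real_lt (hτ : 0 < τ) : ∃ h : ℝ, 0 < h ∧ (h : EReal) < τ := by
  obtain ⟨h, h1, h2⟩ := EReal.lt_iff_exists_real_btwn.1 hτ
  exact ⟨h, by exact_mod_cast h1, h2⟩

lemma MemWLp.mono (h : η ≤ τ) (hf : MemWLp p α τ f) : MemWLp p α η f :=
  hf.mono_measure (Measure.restrict_mono (openTime_mono h) le_rfl)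

lemma wLpNorm_mono (h : η ≤ τ) : wLpNorm p α η f ≤ wLpNorm p α τ f :=
  eLpNorm_mono_measure _ (Measure.restrict_mono (openTime_mono h) le_rfl)

lemma MemWLp.add (hf : MemWLp p α τ f) (hg : MemWLp p α τ g) :
    MemWLp p α τ (fun t => f t + g t) := by
  simp only [MemWLp, smul_add]
  exact MemLp.add hf hg

lemma MemWLp.sub (hf : MemWLp p α τ f) (hg : MemWLp p α τ g) :
    MemWLp p α τ (fun t => f t - g t) := by
  simp only [MemWLp, smul_sub]
  exact MemLp.sub hf hg

lemma wLpNorm_add_le (hp : 1 ≤ p) (hf : MemWLp p α τ f) (hg : MemWLp p α τ g) :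
    wLpNorm p α τ (fun t => f t + g t) ≤ wLpNorm p α τ f + wLpNorm p α τ g := by
  simp only [wLpNorm, smul_add]
  exact eLpNorm_add_le hf.1 hg.1 hp

lemma wLpNorm_congr (h : f =ᵐ[volume.restrict (openTime τ)] g) :
    wLpNorm p α τ f = wLpNorm p α τ g :=
  eLpNorm_congr_ae (by filter_upwards [h] with t ht; rw [ht])

lemma MemWLp.congr (hf : MemWLp p α τ f) (h : f =ᵐ[volume.restrict (openTime τ)] g) :
    MemWLp p α τ g :=
  (memLp_congr_ae (by filter_upwards [h] with t ht; rw [ht])).1 hf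

lemma MemWLp.wLpNorm_lt_top (hf : MemWLp p α τ f) : wLpNorm p α τ f < ∞ := hf.2

lemma wLpNorm_indicator (h : η ≤ τ) :
    wLpNorm p α τ ((openTime η).indicator f) = wLpNorm p α η f := by
  have h1 : (fun t : ℝ => (t ^ α) • (openTime η).indicator f t) =
      (openTime η).indicator (fun t => (t ^ α) • f t) := by
    ext t; by_cases ht : t ∈ openTime η <;> simp [ht]
  rw [wLpNorm, h1, eLpNorm_indicator_eq_eLpNorm_restrict (measurableSet_openTime η),
    Measure.restrict_restrict (measurableSet_openTime η),
    inter_eq_self_of_subset_left (openTime_mono h), wLpNorm]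

lemma memWLp_indicator (h : η ≤ τ) :
    MemWLp p α τ ((openTime η).indicator f) ↔ MemWLp p α η f := by
  have h1 : (fun t : ℝ => (t ^ α) • (openTime η).indicator f t) =
      (openTime η).indicator (fun t => (t ^ α) • f t) := by
    ext t; by_cases ht : t ∈ openTime η <;> simp [ht]
  rw [MemWLp, h1, memLp_indicator_iff_restrict (measurableSet_openTime η),
    Measure.restrict_restrict (measurableSet_openTime η),
    inter_eq_self_of_subset_left (openTime_mono h), MemWLp]

lemma aestronglyMeasurable_rpow (α : ℝ) (μ : Measure ℝ) :
    AEStronglyMeasurable (fun t : ℝ => t ^ α) μ :=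
  (measurable_id.pow_const α).aestronglyMeasurable

lemma aestronglyMeasurable_weight_iff :
    AEStronglyMeasurable (fun t : ℝ => (t ^ α) • f t) (volume.restrict (openTime τ)) ↔
      AEStronglyMeasurable f (volume.restrict (openTime τ)) := by
  refine ⟨fun h => ?_, fun h => (aestronglyMeasurable_rpow α _).smul h⟩
  refine ((aestronglyMeasurable_rpow (-α) _).smul h).congr ?_
  filter_upwards [ae_openTime τ] with t ht
  rw [Pi.smul_apply', smul_smul, ← Real.rpow_add ht.1, neg_add_cancel, Real.rpow_zero, one_smul]

lemma MemWLp.aestronglyMeasurable (hf : MemWLp p α τ f) :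
    AEStronglyMeasurable f (volume.restrict (openTime τ)) :=
  aestronglyMeasurable_weight_iff.1 hf.1

lemma holderTriple_half {p : ℝ≥0∞} : p.HolderTriple p (p / 2) :=
  ⟨by rw [ENNReal.inv_div (by simp) (by simp), ENNReal.div_eq_inv_mul, mul_two]⟩

/-- The weight splits as `t^(2α) = t^α t^α`, one factor for each argument; the rest is Hölder with
`1/p + 1/p = 2/p`. -/
lemma wLpNorm_bilin_le {Z W : Type*} [NormedAddCommGroup Z] [NormedSpace ℂ Z]
    [NormedAddCommGroup W] [NormedSpace ℂ W] (F : Z →L[ℂ] Z →L[ℂ] W) {f g : ℝ → Z}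
    (hf : MemWLp p α τ f) (hg : MemWLp p α τ g) :
    MemWLp (p / 2) (2 * α) τ (fun t => F (f t) (g t)) ∧
      wLpNorm (p / 2) (2 * α) τ (fun t => F (f t) (g t)) ≤
        ‖F‖₊ * wLpNorm p α τ f * wLpNorm p α τ g := by
  have hp := holderTriple_half (p := p)
  have h1 : (fun t : ℝ => (t ^ (2 * α)) • F (f t) (g t)) =ᵐ[volume.restrict (openTime τ)]
      fun t => F (t ^ α • f t) (t ^ α • g t) := by
    filter_upwards [ae_openTime τ] with t ht
    rw [ContinuousLinearMap.map_smul_of_tower, ContinuousLinearMap.map_smul_of_tower,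
      smul_apply, smul_smul, ← Real.rpow_add ht.1, two_mul]
  have h2 : wLpNorm (p / 2) (2 * α) τ (fun t => F (f t) (g t)) ≤
        ‖F‖₊ * wLpNorm p α τ f * wLpNorm p α τ g := by
    rw [wLpNorm, eLpNorm_congr_ae h1]
    refine eLpNorm_le_eLpNorm_mul_eLpNorm'_of_norm hf.1 hg.1 (fun x y => F x y) ‖F‖₊
      (Eventually.of_forall fun t => F.le_opNorm₂ _ _)
  refine ⟨⟨?_, h2.trans_lt ?_⟩, h2⟩
  · exact (aestronglyMeasurable_weight_iff (f := fun t => F (f t) (g t))).2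
      ((F.aestronglyMeasurable_comp₂ hf.aestronglyMeasurable hg.aestronglyMeasurable))
  · exact ENNReal.mul_lt_top (ENNReal.mul_lt_top ENNReal.coe_lt_top hf.2) hg.2

/-- With `1/q' = 1 - 1/q`, the integrability condition `γ q' < 1` is exactly `γ + 1/q < 1`. -/
lemma memLp_rpow_Ioc {q : ℝ≥0∞} (hq : 1 < q) {γ : ℝ} (hγ : γ + (q⁻¹).toReal < 1) {t : ℝ}
    (ht : 0 ≤ t) :
    MemLp (fun s : ℝ => s ^ (-γ)) q.conjExponent (volume.restrict (Ioc 0 t)) := by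
  have hconj := ENNReal.HolderConjugate.conjExponent hq.le
  have h1 : q.conjExponent⁻¹.toReal = 1 - q⁻¹.toReal := by
    have := congrArg ENNReal.toReal (ENNReal.HolderConjugate.inv_add_inv_eq_one q q.conjExponent)
    have hq1 : q⁻¹ ≠ ∞ := by simp [(zero_lt_one.trans hq).ne']
    have hq2 : q.conjExponent⁻¹ ≠ ∞ := by
      rw [Ne, ENNReal.inv_eq_top]; exact ENNReal.HolderConjugate.ne_zero q.conjExponent q
    rw [ENNReal.toReal_add hq1 hq2] at this
    simp only [ENNReal.toReal_one] at this
    linarith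
  have hlt : 0 < 1 - q⁻¹.toReal := by
    have : q⁻¹.toReal < 1 := by
      rw [← ENNReal.toReal_one]
      exact ENNReal.toReal_strict_mono ENNReal.one_ne_top (ENNReal.inv_lt_one.2 hq)
    linarith
  have h0 : q.conjExponent ≠ 0 := ENNReal.HolderConjugate.ne_zero q.conjExponent q
  have htop : q.conjExponent ≠ ∞ := by
    rintro h
    rw [h, ENNReal.inv_top, ENNReal.toReal_zero] at h1
    linarith
  rw [← integrable_norm_rpow_iff (aestronglyMeasurable_rpow _ _) h0 htop]
  have hr : q.conjExponent.toReal = (1 - q⁻¹.toReal)⁻¹ := by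
    rw [← h1, ENNReal.toReal_inv, inv_inv]
  have h3 : IntegrableOn (fun s : ℝ => s ^ (-γ * q.conjExponent.toReal)) (Ioc 0 t) := by
    rw [← intervalIntegrable_iff_integrableOn_Ioc_of_le ht]
    apply intervalIntegral.intervalIntegrable_rpow'
    rw [hr, neg_mul, neg_lt_neg_iff, ← div_eq_mul_inv, div_lt_one hlt]
    linarith
  refine h3.congr ?_
  filter_upwards [ae_restrict_mem measurableSet_Ioc] with s hs
  rw [Real.norm_of_nonneg (Real.rpow_nonneg hs.1.le _), ← Real.rpow_mul hs.1.le]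

/-- Weighted Lebesgue spaces embed into the integrable functions on bounded intervals. -/
lemma exists_eLpNorm_one_le {q : ℝ≥0∞} (hq : 1 < q) {γ : ℝ} (hγ : γ + (q⁻¹).toReal < 1) {t : ℝ}
    (ht : 0 ≤ t) : ∃ c : ℝ≥0, ∀ (η : EReal) (f : ℝ → E), (t : EReal) < η → MemWLp q γ η f →
      IntegrableOn f (Ioc 0 t) ∧
        eLpNorm f 1 (volume.restrict (Ioc 0 t)) ≤ c * wLpNorm q γ η f := by
  have hm := memLp_rpow_Ioc hq hγ ht
  have hconj := ENNReal.HolderConjugate.conjExponent hq.le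
  refine ⟨(eLpNorm (fun s : ℝ => s ^ (-γ)) q.conjExponent (volume.restrict (Ioc 0 t))).toNNReal,
    fun η f hη hf => ?_⟩
  rw [ENNReal.coe_toNNReal hm.2.ne]
  have hmono : volume.restrict (Ioc 0 t) ≤ volume.restrict (openTime η) :=
    Measure.restrict_mono (Ioc_subset_openTime hη) le_rfl
  have h1 : f =ᵐ[volume.restrict (Ioc 0 t)] fun s => s ^ (-γ) • (s ^ γ • f s) := by
    filter_upwards [ae_restrict_mem measurableSet_Ioc] with s hs
    rw [smul_smul, ← Real.rpow_add hs.1, neg_add_cancel, Real.rpow_zero, one_smul]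
  have h2 : eLpNorm f 1 (volume.restrict (Ioc 0 t)) ≤
      eLpNorm (fun s : ℝ => s ^ (-γ)) q.conjExponent (volume.restrict (Ioc 0 t)) *
        wLpNorm q γ η f := by
    rw [eLpNorm_congr_ae h1]
    have := hconj.symm
    refine (eLpNorm_le_eLpNorm_mul_eLpNorm'_of_norm (p := q.conjExponent) (q := q)
      (aestronglyMeasurable_rpow (-γ) _)
      (hf.1.mono_measure hmono) (fun a x => a • x) 1
      (Eventually.of_forall fun s => by simp [norm_smul])).trans ?_
    rw [ENNReal.coe_one, one_mul]
    gcongr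
    exact eLpNorm_mono_measure _ hmono
  refine ⟨memLp_one_iff_integrable.1 ⟨hf.aestronglyMeasurable.mono_measure hmono,
    h2.trans_lt (ENNReal.mul_lt_top hm.2 hf.2)⟩, h2⟩

end FunctionSpaces

end

end AbstractKato

/-! ### The singularity of the extrapolated kernel at time zero. -/

namespace AbstractKato

open Filter Topology

/-- A violation would persist on a nonempty open set, which has positive measure. This turns the
essential bounds in [A1] and [A2] into pointwise ones. -/
lemma le_of_ae_le_of_continuousOn {U : Set ℝ} (hU : IsOpen U) {g : ℝ → ℝ} {c : ℝ}
    (hg : ContinuousOn g U) (h : ∀ᵐ t ∂(volume.restrict U), g t ≤ c) {t : ℝ} (ht : t ∈ U) :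
    g t ≤ c := by
  by_contra hlt
  have hopen : IsOpen (U ∩ g ⁻¹' Ioi c) := hg.isOpen_inter_preimage hU isOpen_Ioi
  have hpos := hopen.measure_pos volume ⟨t, ht, not_le.1 hlt⟩
  rw [ae_restrict_iff' hU.measurableSet, ae_iff] at h
  refine hpos.ne' (measure_mono_null (fun s hs => ?_) h)
  simpa [hs.1] using hs.2

/-- Iterating over `r, 2r, 4r, …` produces a geometric series of ratio `2^κ < 1`, so its first term
dominates. -/
lemma exists_le_rpow_of_dyadic {φ : ℝ → ℝ} {c D h κ : ℝ} (hκ : κ < 0) (hh : 0 < h) (hc : 0 ≤ c)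
    (hD : 0 ≤ D) (hstep : ∀ r, 0 < r → r ≤ h → φ r ≤ c * r ^ κ + φ (2 * r))
    (hbase : ∀ r, h ≤ r → r ≤ 2 * h → φ r ≤ D) :
    ∃ c' : ℝ, 0 ≤ c' ∧ ∀ r, 0 < r → r ≤ h → φ r ≤ c' * r ^ κ := by
  have hq : (2 : ℝ) ^ κ < 1 := Real.rpow_lt_one_of_one_lt_of_neg one_lt_two hκ
  have hq' : 0 < 1 - (2 : ℝ) ^ κ := by linarith
  -- The first summand covers the base range, where `1 ≤ (2h)^(-κ) r^κ`; the second makes `c r^κ +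
  -- c' (2r)^κ ≤ c' r^κ`, which closes the induction.
  set c' := D * (2 * h) ^ (-κ) + c / (1 - 2 ^ κ) with hc'
  have hc'1 : c ≤ c' * (1 - 2 ^ κ) := by
    rw [← div_le_iff₀ hq']
    have : 0 ≤ D * (2 * h) ^ (-κ) := by positivity
    linarith
  have hc'0 : 0 ≤ c' := by positivity
  have key : ∀ n : ℕ, ∀ r, h / 2 ^ n ≤ r → r ≤ 2 * h → φ r ≤ c' * r ^ κ := by
    intro n
    induction n with
    | zero =>
      intro r hr hr'
      rw [pow_zero, div_one] at hr
      have hr0 := hh.trans_le hr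
      have h1 : 1 ≤ (2 * h) ^ (-κ) * r ^ κ := by
        rw [Real.rpow_neg (by positivity), ← div_eq_inv_mul, one_le_div (by positivity)]
        exact Real.rpow_le_rpow_of_nonpos hr0 hr' hκ.le
      calc φ r ≤ D := hbase r hr hr'
        _ ≤ D * ((2 * h) ^ (-κ) * r ^ κ) := le_mul_of_one_le_right hD h1
        _ ≤ c' * r ^ κ := by
          rw [hc', add_mul, mul_assoc]
          have : 0 ≤ c / (1 - 2 ^ κ) * r ^ κ := by positivity
          linarith
    | succ n ih =>
      intro r hr hr'
      have hr0 : 0 < r := lt_of_lt_of_le (by positivity) hr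
      rcases le_or_gt r h with hrh | hrh
      · have h2 := ih (2 * r) (by
          rw [pow_succ, ← div_div, div_le_iff₀ two_pos] at hr; linarith) (by linarith)
        rw [Real.mul_rpow two_pos.le hr0.le] at h2
        have h3 := hstep r hr0 hrh
        have h4 : c * r ^ κ ≤ c' * (1 - 2 ^ κ) * r ^ κ := by gcongr
        nlinarith
      · exact ih r ((div_le_self hh.le (one_le_pow₀ one_le_two)).trans hrh.le) hr'
  refine ⟨c', hc'0, fun r hr hrh => ?_⟩
  obtain ⟨n, hn⟩ := pow_unbounded_of_one_lt (h / r) (one_lt_two : (1 : ℝ) < 2)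
  refine key n r ?_ (by linarith)
  rw [div_lt_iff₀ hr] at hn
  rw [div_le_iff₀ (by positivity)]
  linarith

variable {X Z W : Type*} [NormedAddCommGroup X] [NormedSpace ℂ X]
  [NormedAddCommGroup Z] [NormedSpace ℂ Z] [NormedAddCommGroup W] [NormedSpace ℂ W]
  {A : X →ₗ.[ℂ] X} {T : ℝ → X →L[ℂ] X} {C : X →ₗ.[ℂ] Z} {B : W →L[ℂ] Extrap A}
  {p : ℝ≥0∞} {α : ℝ} {τ : EReal}

lemma toReal_half_inv (p : ℝ≥0∞) : (p / 2).toReal⁻¹ = 2 * (p⁻¹).toReal := by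
  rw [ENNReal.toReal_div, ENNReal.toReal_inv, ENNReal.toReal_ofNat, inv_div, div_eq_mul_inv]

lemma wLpNorm_le_of_norm_le {q : ℝ≥0∞} {γ : ℝ} (hγ : 0 ≤ γ) {h : ℝ} (hh : 0 < h) {f : ℝ → W}
    {D : ℝ} (hf : ∀ t ∈ Ioo 0 h, ‖f t‖ ≤ D) :
    wLpNorm q γ (h : EReal) f ≤ ENNReal.ofReal (h ^ (γ + q.toReal⁻¹) * D) := by
  have h1 : ∀ᵐ t ∂(volume.restrict (openTime (h : EReal))), ‖(t ^ γ) • f t‖ ≤ h ^ γ * D := by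
    filter_upwards [ae_openTime (h : EReal)] with t ht
    rw [openTime_coe] at ht
    rw [norm_smul, Real.norm_of_nonneg (Real.rpow_nonneg ht.1.le _)]
    gcongr
    exacts [ht.1.le, ht.2.le, hf t ht]
  refine (eLpNorm_le_of_ae_bound h1).trans ?_
  rw [Measure.restrict_apply_univ, openTime_coe, Real.volume_Ioo, sub_zero,
    ENNReal.ofReal_rpow_of_pos hh, ← ENNReal.ofReal_mul (by positivity), ← mul_assoc,
    ← Real.rpow_add hh, add_comm]

lemma wLpNorm_const_le {q : ℝ≥0∞} {γ : ℝ} (hγ : 0 ≤ γ) {h : ℝ} (hh : 0 < h) (w : W) :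
    wLpNorm q γ (h : EReal) (fun _ => w) ≤ ENNReal.ofReal (h ^ (γ + q.toReal⁻¹) * ‖w‖) :=
  wLpNorm_le_of_norm_le hγ hh fun _ _ => le_rfl

lemma memWLp_const {q : ℝ≥0∞} {γ : ℝ} (hγ : 0 ≤ γ) {h : ℝ} (hh : 0 < h) (w : W) :
    MemWLp q γ (h : EReal) (fun _ => w) :=
  ⟨(aestronglyMeasurable_weight_iff (f := fun _ => w)).2 aestronglyMeasurable_const,
    (wLpNorm_const_le hγ hh w).trans_lt ENNReal.ofReal_lt_top⟩

lemma deriv_eq_sub_shiftedSemigroup (T : ℝ → X →L[ℂ] X) (t : ℝ) :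
    deriv T t = T t - shiftedSemigroup T t := by
  rw [shiftedSemigroup, sub_sub_cancel]

variable [CompleteSpace X]

namespace GeneratesBoundedAnalyticSemigroup

variable (hT : GeneratesBoundedAnalyticSemigroup A T)
include hT

lemma shiftInv_shiftedSemigroup_comm {t : ℝ} (ht : 0 < t) (x : X) :
    shiftInv A (shiftedSemigroup T t x) = shiftedSemigroup T t (shiftInv A x) := by
  rw [hT.shiftInv_shiftedSemigroup ht, hT.shiftedSemigroup_shiftInv ht]

lemma shiftedSemigroup_map {s t : ℝ} (hs : 0 < s) (ht : 0 ≤ t) (x : X) :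
    shiftedSemigroup T s (T t x) = shiftedSemigroup T (s + t) x := by
  apply hT.shiftInv_injective
  rw [hT.shiftInv_shiftedSemigroup hs, hT.shiftInv_shiftedSemigroup (by positivity),
    hT.map_add_apply hs.le ht]

lemma deriv_map {s t : ℝ} (hs : 0 < s) (ht : 0 ≤ t) (x : X) :
    deriv T s (T t x) = deriv T (s + t) x := by
  rw [deriv_eq_sub_shiftedSemigroup, deriv_eq_sub_shiftedSemigroup, sub_apply, sub_apply, hT.shiftedSemigroup_map hs ht,
    hT.map_add_apply hs.le ht]

omit [CompleteSpace X] in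
lemma intervalIntegrable_apply {t : ℝ} (ht : 0 ≤ t) (x : X) :
    IntervalIntegrable (fun s => T s x) volume 0 t := by
  obtain ⟨M, hM, hTM⟩ := hT.exists_norm_le
  rw [intervalIntegrable_iff_integrableOn_Ioc_of_le ht]
  refine IntegrableOn.of_bound (by simp) ?_ (M * ‖x‖) ?_
  · exact ((hT.continuousOn.clm_apply continuousOn_const).mono
      Ioc_subset_Ioi_self).aestronglyMeasurable measurableSet_Ioc
  · filter_upwards [ae_restrict_mem measurableSet_Ioc] with s hs
    exact (T s).le_of_opNorm_le (hTM s hs.1.le) x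

/-- If `(I + A) v` is the primitive of an orbit of the extrapolated semigroup, then `T'(r) v` is an
increment of that orbit. -/
lemma deriv_apply_of_shiftInv_eq_integral {r t : ℝ} (hr : 0 < r) (ht : 0 ≤ t) {v y : X}
    (hv : shiftInv A v = ∫ s in (0 : ℝ)..t, T s y) :
    deriv T r v = shiftedSemigroup T (r + t) y - shiftedSemigroup T r y := by
  -- After applying `(I+A)⁻¹` the claim reads `T'(r) ∫₀ᵗ T(s)y ds = T(r+t)y - T(r)y`, which is the
  -- fundamental theorem of calculus for `s ↦ T(r+s)y`.
  apply hT.shiftInv_injective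
  have h1 : shiftInv A (deriv T r v) = deriv T r (shiftInv A v) := by
    rw [deriv_eq_sub_shiftedSemigroup, sub_apply, sub_apply, map_sub, hT.shiftInv_map r hr.le,
      hT.shiftInv_shiftedSemigroup_comm hr]
  rw [h1, hv, map_sub, hT.shiftInv_shiftedSemigroup (by positivity),
    hT.shiftInv_shiftedSemigroup hr,
    ← ContinuousLinearMap.intervalIntegral_comp_comm _ (hT.intervalIntegrable_apply ht y)]
  have h2 : ∀ s ∈ uIcc 0 t, deriv T r (T s y) = deriv T (r + s) y := by
    intro s hs
    rw [uIcc_of_le ht] at hs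
    exact hT.deriv_map hr hs.1 y
  rw [intervalIntegral.integral_congr h2]
  have h3 : ∀ s ∈ uIcc 0 t, HasDerivAt (fun s => T (r + s) y) (deriv T (r + s) y) s := by
    intro s hs
    rw [uIcc_of_le ht] at hs
    have hs0 := hs.1
    exact (hT.hasDerivAt_apply (t := r + s) (by positivity) y).comp_const_add r s
  rw [intervalIntegral.integral_eq_sub_of_hasDerivAt h3, add_zero]
  have h4 : ContinuousOn (fun s => deriv T (r + s) y) (uIcc 0 t) := by
    refine ContinuousOn.clm_apply ?_ continuousOn_const
    refine hT.hasDerivAt_and_continuousOn_deriv.2.comp (by fun_prop) fun s hs => ?_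
    rw [uIcc_of_le ht] at hs
    have := hs.1
    exact mem_Ioi.2 (by positivity)
  exact h4.intervalIntegrable

/-- For the constant `w` on `(0, 2r)`, [A2] bounds the primitive `v` of `T₋₁(·)Bw` in `X` by a
multiple of `r^β ‖w‖`, `β = 2α + 2/p`. Applying `T'(r)`, of norm at most `K/r`, bounds the increment
of the kernel between `r` and `2r` by a multiple of `r^(β-1) ‖w‖`; since `β < 1`, dyadic summation
applies. -/
lemma exists_shiftedSemigroup_baseMap_le_near_zero (hτ : 0 < τ) (hα : 0 ≤ α)
    (hαp : α + (p⁻¹).toReal < 1 / 2) (hA2 : ConditionA2 A T B p α τ) :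
    ∃ h c : ℝ, 0 < h ∧ (h : EReal) < τ ∧ 0 ≤ c ∧ ∀ t, 0 < t → t ≤ h →
      ‖(shiftedSemigroup T t).comp (baseMap A B)‖ ≤ c * t ^ (2 * α + 2 * (p⁻¹).toReal - 1) := by
  obtain ⟨h₁, hh₁, hh₁τ⟩ := exists_real_lt hτ
  obtain ⟨⟨K, hK, hTK⟩, -⟩ := hT.hasDerivAt_and_continuousOn_deriv
  obtain ⟨M', K', hM', hK', hSK⟩ := hT.exists_norm_shiftedSemigroup_le
  obtain ⟨M, hM⟩ := hA2
  set β := 2 * α + 2 * (p⁻¹).toReal with hβ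
  have hstep : ∀ r, 0 < r → r ≤ h₁ / 2 → ‖(shiftedSemigroup T r).comp (baseMap A B)‖ ≤
      (K * M * 2 ^ β) * r ^ (β - 1) + ‖(shiftedSemigroup T (2 * r)).comp (baseMap A B)‖ := by
    intro r hr hrh
    refine ContinuousLinearMap.opNorm_le_bound _ (by positivity) fun w => ?_
    have hle : ((2 * r : ℝ) : EReal) ≤ τ :=
      (EReal.coe_le_coe_iff.2 (by linarith : 2 * r ≤ h₁)).trans hh₁τ.le
    have hmem := (memWLp_indicator (p := p / 2) (α := 2 * α) (f := fun _ => w) hle).2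
      (memWLp_const (by positivity) (by positivity) w)
    obtain ⟨v, -, hv, hvn⟩ := hM _ hmem
    rw [wLpNorm_indicator hle] at hvn
    have hvn' : eLpNorm v ∞ (volume.restrict (openTime τ)) ≤
        ENNReal.ofReal (M * ((2 * r) ^ β * ‖w‖)) := by
      refine hvn.trans ?_
      rw [ENNReal.ofReal_mul M.coe_nonneg, ENNReal.ofReal_coe_nnreal, hβ, ← toReal_half_inv]
      gcongr
      exact wLpNorm_const_le (by positivity) (by positivity) w
    have hvae : ∀ᵐ t ∂(volume.restrict (openTime τ)), ‖v t‖ ≤ M * ((2 * r) ^ β * ‖w‖) := by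
      filter_upwards [ae_le_eLpNormEssSup (f := v) (μ := volume.restrict (openTime τ))] with t ht
      rw [← eLpNorm_exponent_top] at ht
      have := ht.trans hvn'
      rwa [← ofReal_norm, ENNReal.ofReal_le_ofReal_iff (by positivity)] at this
    set y := baseMap A B w
    have hae : ∀ᵐ t ∂(volume.restrict (openTime ((2 * r : ℝ) : EReal))),
        ‖shiftedSemigroup T (r + t) y - shiftedSemigroup T r y‖ ≤
          K / r * (M * ((2 * r) ^ β * ‖w‖)) := by
      filter_upwards [ae_openTime_mono hle hv, ae_openTime_mono hle hvae, ae_openTime _]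
        with t ht htn htm
      have ht0 : 0 < t := htm.1
      rw [embed_eq_convB_iff] at ht
      have h1 : shiftInv A (v t) = ∫ s in (0 : ℝ)..t, T s y := by
        rw [ht]
        have h2 : ∀ s ∈ Ioc 0 t, T (t - s) (baseMap A B
            ((openTime ((2 * r : ℝ) : EReal)).indicator (fun _ => w) s)) = T (t - s) y := by
          intro s hs
          rw [indicator_of_mem (Ioc_subset_openTime htm.2 hs)]
        rw [intervalIntegral.integral_congr_ae
          (Eventually.of_forall fun s hs => h2 s (by rwa [uIoc_of_le ht0.le] at hs)),
          intervalIntegral.integral_comp_sub_left (fun s => T s y) t, sub_self, sub_zero]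
      rw [← hT.deriv_apply_of_shiftInv_eq_integral hr ht0.le h1]
      refine ((deriv T r).le_of_opNorm_le (hTK r hr).2 _).trans ?_
      gcongr
    have hcont : ContinuousOn
        (fun t => ‖shiftedSemigroup T (r + t) y - shiftedSemigroup T r y‖) (Ioo 0 (2 * r)) := by
      refine ContinuousOn.norm (ContinuousOn.sub ?_ continuousOn_const)
      refine ContinuousOn.clm_apply ?_ continuousOn_const
      refine hT.continuousOn_shiftedSemigroup.comp (by fun_prop) fun s hs => ?_
      have := hs.1
      exact mem_Ioi.2 (by positivity)
    rw [openTime_coe] at hae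
    -- [A2] only speaks about almost every `t`. The interval has length `2r` so that `t = r` is an
    -- interior point, where continuity gives the bound.
    have hfin := le_of_ae_le_of_continuousOn isOpen_Ioo hcont hae (t := r)
      ⟨hr, by linarith⟩
    rw [← two_mul] at hfin
    have h5 : K / r * (M * ((2 * r) ^ β * ‖w‖)) = K * M * 2 ^ β * r ^ (β - 1) * ‖w‖ := by
      rw [Real.mul_rpow two_pos.le hr.le, Real.rpow_sub hr, Real.rpow_one]
      field_simp
    rw [h5, norm_sub_rev] at hfin
    have h6 : ‖shiftedSemigroup T (2 * r) y‖ ≤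
        ‖(shiftedSemigroup T (2 * r)).comp (baseMap A B)‖ * ‖w‖ :=
      ((shiftedSemigroup T (2 * r)).comp (baseMap A B)).le_opNorm w
    have h7 := norm_sub_norm_le (shiftedSemigroup T r y) (shiftedSemigroup T (2 * r) y)
    rw [ContinuousLinearMap.comp_apply, add_mul]
    linarith
  obtain ⟨c, hc, hbound⟩ := exists_le_rpow_of_dyadic
    (φ := fun r => ‖(shiftedSemigroup T r).comp (baseMap A B)‖) (h := h₁ / 2)
    (c := K * M * 2 ^ β) (κ := β - 1) (D := (M' + K' / (h₁ / 2)) * ‖baseMap A B‖)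
    (by linarith) (by positivity) (by positivity) (by positivity) hstep (by
      intro r hr _
      refine (ContinuousLinearMap.opNorm_comp_le _ _).trans ?_
      gcongr
      refine (hSK r (lt_of_lt_of_le (by positivity) hr)).trans ?_
      gcongr)
  exact ⟨h₁ / 2, c, by positivity,
    (EReal.coe_lt_coe_iff.2 (by linarith)).trans hh₁τ, hc, hbound⟩

/-- The kernel `T₋₁(t) B : W → X` has an integrable singularity at `0`. -/
lemma exists_shiftedSemigroup_baseMap_le (hτ : 0 < τ) (hα : 0 ≤ α)
    (hαp : α + (p⁻¹).toReal < 1 / 2) (hA2 : ConditionA2 A T B p α τ) :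
    ∃ c d : ℝ, 0 ≤ c ∧ 0 ≤ d ∧ ∀ t, 0 < t → ∀ w,
      ‖shiftedSemigroup T t (baseMap A B w)‖ ≤
        (c * t ^ (2 * α + 2 * (p⁻¹).toReal - 1) + d) * ‖w‖ := by
  obtain ⟨h, c, hh, -, hc, hbound⟩ :=
    hT.exists_shiftedSemigroup_baseMap_le_near_zero hτ hα hαp hA2
  obtain ⟨M', K', hM', hK', hSK⟩ := hT.exists_norm_shiftedSemigroup_le
  refine ⟨c, (M' + K' / h) * ‖baseMap A B‖, hc, by positivity, fun t ht w => ?_⟩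
  refine ((shiftedSemigroup T t).comp (baseMap A B)).le_of_opNorm_le ?_ w
  rcases le_or_gt t h with hth | hth
  · exact (hbound t ht hth).trans (le_add_of_nonneg_right (by positivity))
  · refine ((ContinuousLinearMap.opNorm_comp_le _ _).trans ?_).trans
      (le_add_of_nonneg_left (by positivity))
    gcongr
    refine (hSK t ht).trans ?_
    gcongr

end GeneratesBoundedAnalyticSemigroup

end AbstractKato

/-! ### Convolutions with bounded inhomogeneities. -/

namespace AbstractKato

open Filter Topology

variable {X Z W : Type*} [NormedAddCommGroup X] [NormedSpace ℂ X]
  [NormedAddCommGroup Z] [NormedSpace ℂ Z] [NormedAddCommGroup W] [NormedSpace ℂ W]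
  {A : X →ₗ.[ℂ] X} {T : ℝ → X →L[ℂ] X} {C : X →ₗ.[ℂ] Z} {B : W →L[ℂ] Extrap A}
  {p : ℝ≥0∞} {α : ℝ} {τ η : EReal} {u : ℝ → W}

lemma aestronglyMeasurable_convolution_integrand {G : ℝ → X →L[ℂ] Z} (hG : ContinuousOn G (Ioi 0))
    {t : ℝ} {f : ℝ → X} (hf : AEStronglyMeasurable f (volume.restrict (Ioc 0 t))) :
    AEStronglyMeasurable (fun s => G (t - s) (f s)) (volume.restrict (Ioc 0 t)) := by
  have h1 : ContinuousOn (fun s => G (t - s)) (Ioo 0 t) :=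
    hG.comp (by fun_prop) fun s hs => mem_Ioi.2 (sub_pos.2 hs.2)
  have h2 := h1.aestronglyMeasurable (μ := volume) measurableSet_Ioo
  rw [Measure.restrict_congr_set Ioo_ae_eq_Ioc] at h2
  exact (ContinuousLinearMap.id ℂ (X →L[ℂ] Z)).aestronglyMeasurable_comp₂ h2 hf

lemma convB_congr {u' : ℝ → W} {t : ℝ} (ht : 0 ≤ t)
    (h : ∀ᵐ s ∂(volume.restrict (Ioc 0 t)), u s = u' s) :
    convB A T B u t = convB A T B u' t := by
  refine intervalIntegral.integral_congr_ae_restrict ?_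
  rw [uIoc_of_le ht]
  filter_upwards [h] with s hs
  rw [hs]

lemma ae_restrict_Ioc_of_ae_openTime {t : ℝ} (ht : (t : EReal) < η) {P : ℝ → Prop}
    (h : ∀ᵐ s ∂(volume.restrict (openTime η)), P s) : ∀ᵐ s ∂(volume.restrict (Ioc 0 t)), P s :=
  ae_restrict_of_ae_restrict_of_subset (Ioc_subset_openTime ht) h

namespace GeneratesBoundedAnalyticSemigroup

variable (hT : GeneratesBoundedAnalyticSemigroup A T)
include hT

/-- After `(I+A₋₁)⁻¹` the kernel is bounded, so integrability of `u` suffices. Thus the convolution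
depends continuously in `X₋₁` on `u` in `L¹`, which later identifies limits. -/
lemma exists_orbit_convolution_le : ∃ M : ℝ, 0 ≤ M ∧ ∀ (u : ℝ → W) (t : ℝ), 0 ≤ t →
    IntegrableOn u (Ioc 0 t) →
      IntervalIntegrable (fun s => T (t - s) (baseMap A B (u s))) volume 0 t ∧
      ‖∫ s in (0 : ℝ)..t, T (t - s) (baseMap A B (u s))‖ ≤
        M * (eLpNorm u 1 (volume.restrict (Ioc 0 t))).toReal := by
  obtain ⟨M, hM, hTM⟩ := hT.exists_norm_le
  refine ⟨M * ‖baseMap A B‖, by positivity, fun u t ht hu => ?_⟩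
  have hb : ∀ s ∈ Ioc 0 t, ‖T (t - s) (baseMap A B (u s))‖ ≤ M * ‖baseMap A B‖ * ‖u s‖ := by
    intro s hs
    rw [mul_assoc]
    exact ((T (t - s)).le_of_opNorm_le (hTM _ (sub_nonneg.2 hs.2)) _).trans
      (by gcongr; exact (baseMap A B).le_opNorm _)
  have hint : IntegrableOn (fun s => M * ‖baseMap A B‖ * ‖u s‖) (Ioc 0 t) := hu.norm.const_mul _
  have h1 : IntegrableOn (fun s => T (t - s) (baseMap A B (u s))) (Ioc 0 t) := by
    refine Integrable.mono' hint (aestronglyMeasurable_convolution_integrand hT.continuousOn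
      ((baseMap A B).continuous.comp_aestronglyMeasurable hu.1)) ?_
    filter_upwards [ae_restrict_mem measurableSet_Ioc] with s hs using hb s hs
  refine ⟨(intervalIntegrable_iff_integrableOn_Ioc_of_le ht).2 h1, ?_⟩
  rw [intervalIntegral.integral_of_le ht]
  refine (norm_integral_le_of_norm_le hint ?_).trans_eq ?_
  · filter_upwards [ae_restrict_mem measurableSet_Ioc] with s hs using hb s hs
  · rw [integral_const_mul, eLpNorm_one_eq_lintegral_enorm, integral_norm_eq_lintegral_enorm hu.1]

lemma convB_sub {u' : ℝ → W} {t : ℝ} (ht : 0 ≤ t) (hu : IntegrableOn u (Ioc 0 t))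
    (hu' : IntegrableOn u' (Ioc 0 t)) :
    convB A T B (fun s => u s - u' s) t = convB A T B u t - convB A T B u' t := by
  obtain ⟨M, -, hM⟩ := hT.exists_orbit_convolution_le (B := B)
  rw [convB_eq, convB_eq, convB_eq, ← map_sub,
    ← intervalIntegral.integral_sub (hM u t ht hu).1 (hM u' t ht hu').1]
  simp only [map_sub]

variable [CompleteSpace X]

lemma continuousOn_orbit_convolution {N : ℝ} (hu : AEStronglyMeasurable u volume)
    (hN : ∀ s, ‖u s‖ ≤ N) :
    ContinuousOn (fun t => ∫ s in (0 : ℝ)..t, T (t - s) (baseMap A B (u s))) (Ici 0) := by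
  obtain ⟨M, hM, hTM⟩ := hT.exists_norm_le
  intro t₀ ht₀
  -- The indicator places all integrals on one fixed interval, so dominated convergence applies; the
  -- integrand can be discontinuous at `t₀` only for `s = t₀`, a null set.
  set f : ℝ → ℝ → X := fun t => (Ioc 0 t).indicator fun s => T (t - s) (baseMap A B (u s)) with hf
  have hlt : ∀ᶠ t in 𝓝[Ici 0] t₀, 0 ≤ t ∧ t ≤ t₀ + 1 := by
    filter_upwards [self_mem_nhdsWithin,
      nhdsWithin_le_nhds (Iic_mem_nhds (lt_add_one t₀))] with t h1 h2 using ⟨h1, h2⟩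
  have heq : ∀ t, 0 ≤ t → t ≤ t₀ + 1 → ∫ s in (0 : ℝ)..t, T (t - s) (baseMap A B (u s)) =
      ∫ s, f t s ∂(volume.restrict (Ioc 0 (t₀ + 1))) := by
    intro t h1 h2
    rw [hf, integral_indicator measurableSet_Ioc, intervalIntegral.integral_of_le h1,
      Measure.restrict_restrict measurableSet_Ioc,
      inter_eq_self_of_subset_left (Ioc_subset_Ioc_right h2)]
  have hN0 : 0 ≤ N := (norm_nonneg _).trans (hN 0)
  have hcont : ContinuousWithinAt (fun t => ∫ s, f t s ∂(volume.restrict (Ioc 0 (t₀ + 1))))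
      (Ici 0) t₀ := by
    refine continuousWithinAt_of_dominated (bound := fun _ => M * (‖baseMap A B‖ * N)) ?_ ?_
      (integrable_const _) ?_
    · filter_upwards [hlt] with t ht
      rw [aestronglyMeasurable_indicator_iff measurableSet_Ioc,
        Measure.restrict_restrict measurableSet_Ioc,
        inter_eq_self_of_subset_left (Ioc_subset_Ioc_right ht.2)]
      exact aestronglyMeasurable_convolution_integrand hT.continuousOn
        ((baseMap A B).continuous.comp_aestronglyMeasurable hu.restrict)
    · filter_upwards [hlt] with t ht
      refine Eventually.of_forall fun s => ?_
      simp only [hf]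
      by_cases hs : s ∈ Ioc 0 t
      · rw [indicator_of_mem hs]
        refine ((T (t - s)).le_of_opNorm_le (hTM _ (sub_nonneg.2 hs.2)) _).trans ?_
        gcongr
        exact (baseMap A B).le_opNorm_of_le (hN s)
      · rw [indicator_of_notMem hs, norm_zero]
        positivity
    · have hne : ∀ᵐ s ∂(volume.restrict (Ioc 0 (t₀ + 1))), s ≠ t₀ :=
        ae_restrict_of_ae (Measure.ae_ne volume t₀)
      filter_upwards [hne, ae_restrict_mem measurableSet_Ioc] with s hs hs0
      rcases lt_or_gt_of_ne hs with hs | hs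
      · have h1 : ContinuousAt (fun t => T (t - s) (baseMap A B (u s))) t₀ :=
          ((hT.hasDerivAt_apply (sub_pos.2 hs) _).comp_sub_const t₀ s).continuousAt
        refine (h1.congr ?_).continuousWithinAt
        filter_upwards [lt_mem_nhds hs] with t ht
        simp only [hf]
        rw [indicator_of_mem (show s ∈ Ioc 0 t from ⟨hs0.1, ht.le⟩)]
      · have h1 : ContinuousAt (fun _ : ℝ => (0 : X)) t₀ := continuousAt_const
        refine (h1.congr ?_).continuousWithinAt
        filter_upwards [gt_mem_nhds hs] with t ht
        simp only [hf]
        rw [indicator_of_notMem (fun h : s ∈ Ioc 0 t => not_le.2 ht h.2)]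
  refine hcont.congr_of_eventuallyEq ?_ (heq t₀ ht₀ (by linarith))
  filter_upwards [hlt] with t ht using heq t ht.1 ht.2

section BoundedForcing

variable {c d κ N : ℝ} (hκ : -1 < κ) (hd : 0 ≤ d) (hc : 0 ≤ c)
  (hS : ∀ t, 0 < t → ∀ w, ‖shiftedSemigroup T t (baseMap A B w)‖ ≤ (c * t ^ κ + d) * ‖w‖)
  (hu : AEStronglyMeasurable u volume) (hN : ∀ s, ‖u s‖ ≤ N)
include hκ hd hc hS hu hN

/-- The singularity is integrable because `κ > -1`. The bound depends only on `t - a` and vanishes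
with it, hence controls uniformly in `t` the error of removing the last piece of the integral. -/
lemma intervalIntegrable_shifted_convolution {a t : ℝ} (ha : 0 ≤ a) (hat : a ≤ t) :
    IntervalIntegrable (fun s => shiftedSemigroup T (t - s) (baseMap A B (u s))) volume a t ∧
    ‖∫ s in a..t, shiftedSemigroup T (t - s) (baseMap A B (u s))‖ ≤
      (c * ((t - a) ^ (κ + 1) / (κ + 1)) + d * (t - a)) * N := by
  have hb0 : IntervalIntegrable (fun r : ℝ => (c * r ^ κ + d) * N) volume 0 (t - a) :=
    (((intervalIntegral.intervalIntegrable_rpow' hκ).const_mul c).add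
      intervalIntegrable_const).mul_const N
  have hb : IntervalIntegrable (fun s : ℝ => (c * (t - s) ^ κ + d) * N) volume a t := by
    have := (hb0.comp_sub_left t).symm
    simpa using this
  have hle : ∀ᵐ s, s ∈ Ioc a t →
      ‖shiftedSemigroup T (t - s) (baseMap A B (u s))‖ ≤ (c * (t - s) ^ κ + d) * N := by
    filter_upwards [Measure.ae_ne volume t] with s hs hsm
    have hst : 0 < t - s := sub_pos.2 (lt_of_le_of_ne hsm.2 hs)
    refine (hS _ hst _).trans ?_
    gcongr
    exact hN s
  have hm := (aestronglyMeasurable_convolution_integrand hT.continuousOn_shiftedSemigroup (t := t)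
        ((baseMap A B).continuous.comp_aestronglyMeasurable hu.restrict)).mono_measure
          (Measure.restrict_mono (Ioc_subset_Ioc_left ha) le_rfl)
  refine ⟨?_, ?_⟩
  · rw [intervalIntegrable_iff_integrableOn_Ioc_of_le hat] at hb ⊢
    exact Integrable.mono' hb hm ((ae_restrict_iff' measurableSet_Ioc).2 hle)
  · refine (intervalIntegral.norm_integral_le_of_norm_le hat hle hb).trans_eq ?_
    rw [intervalIntegral.integral_comp_sub_left (fun r : ℝ => (c * r ^ κ + d) * N) t, sub_self,
      intervalIntegral.integral_mul_const, intervalIntegral.integral_add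
        ((intervalIntegral.intervalIntegrable_rpow' hκ).const_mul c) intervalIntegrable_const,
      intervalIntegral.integral_const_mul, integral_rpow (Or.inl hκ),
      Real.zero_rpow (by linarith), intervalIntegral.integral_const]
    simp [mul_comm]

/-- For bounded inhomogeneities the convolution is a continuous function with values in `X`. -/
lemma exists_continuousOn_eq_convB_of_bounded :
    ∃ v : ℝ → X, ContinuousOn v (Ici 0) ∧ (∀ t, 0 ≤ t → v t ∈ closure (A.domain : Set X)) ∧
      ∀ t, 0 ≤ t → embed A (v t) = convB A T B u t := by
  have hint := fun (a t : ℝ) => hT.intervalIntegrable_shifted_convolution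
    (a := a) (t := t) hκ hd hc hS hu hN
  set v : ℝ → X := fun t => ∫ s in (0 : ℝ)..t, shiftedSemigroup T (t - s) (baseMap A B (u s))
    with hv
  set w : ℝ → X := fun t => ∫ s in (0 : ℝ)..t, T (t - s) (baseMap A B (u s)) with hw
  set ω : ℝ → ℝ := fun δ => (c * (δ ^ (κ + 1) / (κ + 1)) + d * δ) * N with hω
  have hN0 : 0 ≤ N := (norm_nonneg _).trans (hN 0)
  have hvw : ∀ t, 0 ≤ t → shiftInv A (v t) = w t := by
    intro t ht
    rw [hv, hw]
    beta_reduce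
    rw [← ContinuousLinearMap.intervalIntegral_comp_comm _ (hint 0 t le_rfl ht).1]
    refine intervalIntegral.integral_congr_ae ?_
    rw [uIoc_of_le ht]
    filter_upwards [Measure.ae_ne volume t] with s hs hsm
    exact hT.shiftInv_shiftedSemigroup (sub_pos.2 (lt_of_le_of_ne hsm.2 hs)) _
  have hwc : ContinuousOn w (Ici 0) := hT.continuousOn_orbit_convolution hu hN
  -- For `t ≥ δ` this is the convolution truncated at `t - δ`, written as a bounded operator applied
  -- to the continuous `w`; it takes values in `D(A)`. The maximum with `0` makes it vanish for `t ≤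
  -- δ`, as `w 0 = 0`.
  set vδ : ℝ → ℝ → X := fun δ t => shiftedSemigroup T δ (w (max (t - δ) 0)) with hvδ
  have hvδc : ∀ δ, Continuous (vδ δ) := fun δ =>
    (shiftedSemigroup T δ).continuous.comp (hwc.comp_continuous (by fun_prop)
      fun t => mem_Ici.2 (le_max_right _ _))
  have hωmono : ∀ a b, 0 ≤ a → a ≤ b → ω a ≤ ω b := by
    intro a b ha hab
    have : 0 < κ + 1 := by linarith
    simp only [hω]
    gcongr
  have hclose : ∀ δ, 0 < δ → ∀ t, 0 ≤ t → ‖v t - vδ δ t‖ ≤ ω δ := by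
    intro δ hδ t ht
    rcases le_or_gt t δ with htδ | htδ
    · have h0 : vδ δ t = 0 := by
        simp [hvδ, hw, max_eq_right (sub_nonpos.2 htδ)]
      rw [h0, sub_zero]
      have := (hint 0 t le_rfl ht).2
      rw [sub_zero] at this
      exact this.trans (hωmono t δ ht htδ)
    · have htδ' : 0 ≤ t - δ := by linarith
      have hi := (hint (t - δ) t htδ' (by linarith))
      have hi0 := (hint 0 t le_rfl ht).1
      have hi1 : IntervalIntegrable
          (fun s => shiftedSemigroup T (t - s) (baseMap A B (u s))) volume 0 (t - δ) :=
        hi0.mono_set (by rw [uIcc_of_le htδ', uIcc_of_le ht]; exact Icc_subset_Icc_right (by linarith))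
      have h0 : vδ δ t = ∫ s in (0 : ℝ)..(t - δ), shiftedSemigroup T (t - s) (baseMap A B (u s)) := by
        simp only [hvδ, max_eq_left htδ']
        rw [← hvw _ htδ', hT.shiftedSemigroup_shiftInv hδ, hv]
        beta_reduce
        rw [← ContinuousLinearMap.intervalIntegral_comp_comm _ (hint 0 _ le_rfl htδ').1]
        refine intervalIntegral.integral_congr_ae ?_
        rw [uIoc_of_le htδ']
        filter_upwards [Measure.ae_ne volume (t - δ)] with s hs hsm
        rw [← hT.shiftedSemigroup_add hδ.le (sub_pos.2 (lt_of_le_of_ne hsm.2 hs))]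
        congr 2
        ring
      have h2 : v t - vδ δ t =
          ∫ s in (t - δ)..t, shiftedSemigroup T (t - s) (baseMap A B (u s)) := by
        rw [h0, hv, sub_eq_iff_eq_add', intervalIntegral.integral_add_adjacent_intervals hi1 hi.1]
      rw [h2]
      have := hi.2
      rwa [sub_sub_cancel] at this
  have hω0 : Tendsto ω (𝓝[>] 0) (𝓝 0) := by
    have h1 : ContinuousAt ω 0 := by
      have h2 : ContinuousAt (fun δ : ℝ => δ ^ (κ + 1)) 0 :=
        Real.continuousAt_rpow_const _ _ (Or.inr (by linarith))
      simp only [hω]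
      fun_prop
    have h3 : ω 0 = 0 := by
      simp [hω, Real.zero_rpow (show κ + 1 ≠ 0 by linarith)]
    have := h1.tendsto
    rw [h3] at this
    exact this.mono_left nhdsWithin_le_nhds
  have hunif : TendstoUniformlyOn vδ v (𝓝[>] 0) (Ici 0) := by
    rw [Metric.tendstoUniformlyOn_iff]
    intro ε hε
    filter_upwards [hω0.eventually (gt_mem_nhds hε), self_mem_nhdsWithin] with δ hδ hδ0 t ht
    rw [dist_eq_norm]
    exact (hclose δ hδ0 t ht).trans_lt hδ
  refine ⟨v, hunif.continuousOn (Frequently.of_forall fun δ => (hvδc δ).continuousOn),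
    fun t ht => ?_, fun t ht => embed_eq_convB_iff.2 (hvw t ht)⟩
  refine mem_closure_of_tendsto (hunif.tendsto_at ht) ?_
  filter_upwards [self_mem_nhdsWithin] with δ hδ
  exact hT.shiftedSemigroup_mem_domain hδ _

end BoundedForcing

end GeneratesBoundedAnalyticSemigroup

end AbstractKato

/-! ### Continuity of the convolution for general inhomogeneities. -/

namespace AbstractKato

open Filter Topology

/-- Functions in a weighted Lebesgue space whose norms on `(0, h)` vanish as `h → 0` are
approximated by bounded functions. -/
lemma exists_bounded_approx {W : Type*} [NormedAddCommGroup W] [NormedSpace ℂ W]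
    {q : ℝ≥0∞} (hq : 1 ≤ q) {γ : ℝ} (hγ : 0 ≤ γ) {η : EReal} {u : ℝ → W}
    (hu : MemWLp q γ η u)
    (hu0 : Tendsto (fun h : ℝ => wLpNorm q γ h u) (𝓝[>] 0) (𝓝 0)) {ε : ℝ} (hε : 0 < ε) :
    ∃ u' : ℝ → W, AEStronglyMeasurable u' volume ∧ (∃ N : ℝ, ∀ s, ‖u' s‖ ≤ N) ∧
      MemWLp q γ η u' ∧ wLpNorm q γ η (fun s => u s - u' s) ≤ ENNReal.ofReal ε := by
  obtain ⟨h, hh, hh0⟩ := ((hu0.eventually (gt_mem_nhds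
    (ENNReal.ofReal_pos.2 (half_pos hε)))).and self_mem_nhdsWithin).exists
  obtain ⟨g, hg, hgu⟩ := hu.1
  have hgm : MemLp g q (volume.restrict (openTime η)) := (memLp_congr_ae hgu).1 hu
  obtain ⟨K, hK⟩ := hgm.eLpNorm_indicator_norm_ge_le hg (half_pos hε)
  -- On `D` the weighted function `g` is bounded by `K` and the inverse weight by `h^(-γ)`. The
  -- discarded part is small near `0` by `hu0`, and small where `‖g‖ ≥ K` by uniform integrability.
  set D : Set ℝ := openTime η ∩ Ici h ∩ {x | K ≤ ‖g x‖}ᶜ with hD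
  have hDK : MeasurableSet {x | K ≤ ‖g x‖} := measurableSet_le measurable_const hg.norm.measurable
  have hDm : MeasurableSet D :=
    ((measurableSet_openTime η).inter measurableSet_Ici).inter hDK.compl
  set u' : ℝ → W := D.indicator fun t => t ^ (-γ) • g t with hu'
  have hm : AEStronglyMeasurable u' volume :=
    ((aestronglyMeasurable_rpow (-γ) volume).smul hg.aestronglyMeasurable).indicator hDm
  have hw : ∀ᵐ t ∂(volume.restrict (openTime η)), t ^ γ • u' t = D.indicator g t := by
    filter_upwards [ae_openTime η] with t ht
    simp only [hu']
    by_cases htD : t ∈ D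
    · rw [indicator_of_mem htD, indicator_of_mem htD, smul_smul, ← Real.rpow_add ht.1,
        add_neg_cancel, Real.rpow_zero, one_smul]
    · rw [indicator_of_notMem htD, indicator_of_notMem htD, smul_zero]
  refine ⟨u', hm, ⟨h ^ (-γ) * max K 0, fun s => ?_⟩, (memLp_congr_ae hw).2 (hgm.indicator hDm), ?_⟩
  · simp only [hu']
    by_cases hs : s ∈ D
    · rw [indicator_of_mem hs, norm_smul]
      have hs1 : h ≤ s := hs.1.2
      have hs2 : ‖g s‖ ≤ K := (not_le.1 (show ¬ K ≤ ‖g s‖ from hs.2)).le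
      rw [Real.norm_of_nonneg (Real.rpow_nonneg (hh0.le.trans hs1) _)]
      gcongr ?_ * ?_
      · exact Real.rpow_le_rpow_of_nonpos hh0 hs1 (by linarith)
      · exact hs2.trans (le_max_left _ _)
    · rw [indicator_of_notMem hs, norm_zero]
      positivity
  · have heq : (fun t : ℝ => t ^ γ • (u t - u' t)) =ᵐ[volume.restrict (openTime η)]
        (Iio h).indicator g + (Ici h).indicator ({x | K ≤ ‖g x‖}.indicator g) := by
      filter_upwards [hw, hgu, ae_openTime η] with t h1 h2 h3
      rw [smul_sub, h1, h2, Pi.add_apply]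
      by_cases ht : t < h
      · have h4 : t ∉ D := fun h' => not_le.2 ht h'.1.2
        simp [h4, ht]
      · rw [not_lt] at ht
        by_cases hk : K ≤ ‖g t‖
        · have h4 : t ∉ D := fun h' => h'.2 hk
          simp [h4, ht, hk]
        · have h4 : t ∈ D := ⟨⟨h3, ht⟩, hk⟩
          simp [h4, ht, hk]
    rw [wLpNorm, eLpNorm_congr_ae heq]
    refine (eLpNorm_add_le (hgm.1.indicator measurableSet_Iio)
      ((hgm.1.indicator hDK).indicator measurableSet_Ici) hq).trans ?_
    rw [← add_halves ε, ENNReal.ofReal_add (by positivity) (by positivity)]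
    refine add_le_add ?_ ((eLpNorm_indicator_le _).trans hK)
    refine le_trans ?_ hh.le
    rw [eLpNorm_indicator_eq_eLpNorm_restrict measurableSet_Iio,
      Measure.restrict_restrict measurableSet_Iio]
    have hsub : Iio h ∩ openTime η ⊆ openTime (h : EReal) := by
      rw [openTime_coe]
      exact fun t ht => ⟨ht.2.1, ht.1⟩
    rw [eLpNorm_congr_ae (g := fun t : ℝ => t ^ γ • u t) (by
      filter_upwards [ae_restrict_of_ae_restrict_of_subset inter_subset_right hgu] with t ht
        using ht.symm)]
    exact eLpNorm_mono_measure _ (Measure.restrict_mono hsub le_rfl)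

variable {X Z W : Type*} [NormedAddCommGroup X] [NormedSpace ℂ X]
  [NormedAddCommGroup Z] [NormedSpace ℂ Z] [NormedAddCommGroup W] [NormedSpace ℂ W]
  {A : X →ₗ.[ℂ] X} {T : ℝ → X →L[ℂ] X} {C : X →ₗ.[ℂ] Z} {B : W →L[ℂ] Extrap A}
  {p : ℝ≥0∞} {α : ℝ} {τ η : EReal} {u : ℝ → W}

lemma one_lt_half (hp : 2 < p) : 1 < p / 2 := by
  rw [ENNReal.lt_div_iff_mul_lt (by simp) (by simp), one_mul]
  exact hp

lemma two_mul_add_inv_half (hαp : α + (p⁻¹).toReal < 1 / 2) :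
    2 * α + ((p / 2)⁻¹).toReal < 1 := by
  rw [ENNReal.toReal_inv, toReal_half_inv]
  linarith

lemma zero_mem_halfOpenTime (hη : 0 < η) : (0 : ℝ) ∈ halfOpenTime η :=
  ⟨le_rfl, by exact_mod_cast hη⟩

lemma openTime_subset_halfOpenTime : openTime η ⊆ halfOpenTime η := fun _ ht => ⟨ht.1.le, ht.2⟩

lemma isOpen_openTime (τ : EReal) : IsOpen (openTime τ) :=
  (isOpen_lt continuous_const continuous_id).inter
    (isOpen_lt continuous_coe_real_ereal continuous_const)

lemma convB_zero (u : ℝ → W) : convB A T B u 0 = 0 := by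
  simp [convB]

omit [NormedSpace ℂ X] in
lemma eLpNorm_top_ae_le {v : ℝ → X} {μ : Measure ℝ} {c : ℝ} (hc : 0 ≤ c)
    (h : eLpNorm v ∞ μ ≤ ENNReal.ofReal c) : ∀ᵐ t ∂μ, ‖v t‖ ≤ c := by
  filter_upwards [ae_le_eLpNormEssSup (f := v) (μ := μ)] with t ht
  rw [← eLpNorm_exponent_top] at ht
  have := ht.trans h
  rwa [← ofReal_norm, ENNReal.ofReal_le_ofReal_iff hc] at this

variable [CompleteSpace X]

namespace GeneratesBoundedAnalyticSemigroup

variable (hT : GeneratesBoundedAnalyticSemigroup A T)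
include hT

omit [CompleteSpace X] in
-- Extending `u` by zero beyond `η` leaves the convolution on `(0, η)` unchanged, so [A2] applies
-- there. Its function agrees almost everywhere with `v` by injectivity of the embedding, and
-- continuity gives the bound at every time.
lemma norm_le_of_embed_eq_convB {M : ℝ≥0} (hA2 : ∀ u : ℝ → W, MemWLp (p / 2) (2 * α) τ u →
    ∃ v : ℝ → X, MemLp v ∞ (volume.restrict (openTime τ)) ∧
      (∀ᵐ t ∂(volume.restrict (openTime τ)), embed A (v t) = convB A T B u t) ∧
      eLpNorm v ∞ (volume.restrict (openTime τ)) ≤ M * wLpNorm (p / 2) (2 * α) τ u)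
    (hη : 0 < η) (hητ : η ≤ τ) (hu : MemWLp (p / 2) (2 * α) η u) {v : ℝ → X}
    (hv : ContinuousOn v (halfOpenTime η))
    (hvu : ∀ t ∈ halfOpenTime η, embed A (v t) = convB A T B u t) {c : ℝ} (hc : 0 ≤ c)
    (huc : M * wLpNorm (p / 2) (2 * α) η u ≤ ENNReal.ofReal c) {t : ℝ}
    (ht : t ∈ halfOpenTime η) : ‖v t‖ ≤ c := by
  rcases ht.1.eq_or_lt with rfl | ht0
  · have h1 : v 0 = 0 := embed_injective hT (by
      rw [hvu 0 (zero_mem_halfOpenTime hη), convB_zero, _root_.map_zero])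
    rw [h1, norm_zero]
    exact hc
  obtain ⟨v', -, hv', hv'n⟩ := hA2 _ ((memWLp_indicator hητ).2 hu)
  rw [wLpNorm_indicator hητ] at hv'n
  refine le_of_ae_le_of_continuousOn (g := fun t => ‖v t‖) (isOpen_openTime η)
    (hv.mono openTime_subset_halfOpenTime).norm ?_ ⟨ht0, ht.2⟩
  filter_upwards [ae_openTime_mono hητ hv', ae_openTime η,
    ae_openTime_mono hητ (eLpNorm_top_ae_le hc (hv'n.trans huc))] with s h1 h2 h3
  have h4 : v s = v' s := embed_injective hT (by
    rw [hvu s ⟨h2.1.le, h2.2⟩, h1]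
    refine convB_congr h2.1.le ?_
    filter_upwards [ae_restrict_mem measurableSet_Ioc] with r hr
    rw [indicator_of_mem (Ioc_subset_openTime h2.2 hr)])
  rwa [h4]

/-- The convolution of the extrapolated semigroup with `B u` is continuous with values in the
closure of the domain. -/
lemma exists_continuousOn_eq_convB (hα : 0 ≤ α) (hp : 2 < p) (hαp0 : 0 < α + (p⁻¹).toReal)
    (hαp : α + (p⁻¹).toReal < 1 / 2) (hA2 : ConditionA2 A T B p α τ) (hη : 0 < η) (hητ : η ≤ τ)
    (hu : MemWLp (p / 2) (2 * α) η u)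
    (hu0 : Tendsto (fun h : ℝ => wLpNorm (p / 2) (2 * α) h u) (𝓝[>] 0) (𝓝 0)) :
    ∃ v : ℝ → X, ContinuousOn v (halfOpenTime η) ∧
      (∀ t ∈ halfOpenTime η, v t ∈ closure (A.domain : Set X)) ∧
      ∀ t ∈ halfOpenTime η, embed A (v t) = convB A T B u t := by
  obtain ⟨c, d, hc, hd, hS⟩ :=
    hT.exists_shiftedSemigroup_baseMap_le (hη.trans_le hητ) hα hαp hA2
  obtain ⟨M, hM⟩ := hA2
  have hq := one_lt_half hp
  have hqα := two_mul_add_inv_half hαp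
  choose! U hUm hUb hUw hUε using fun (ε : ℝ) (hε : 0 < ε) =>
    exists_bounded_approx hq.le (by positivity) hu hu0 hε
  set e : ℕ → ℝ := fun n => 1 / ((n : ℝ) + 1) with he
  have he0 : ∀ n, 0 < e n := fun n => Nat.one_div_pos_of_nat
  have het : Tendsto e atTop (𝓝 0) := tendsto_one_div_add_atTop_nhds_zero_nat
  -- The kernel exponent is `2α + 2/p - 1`; it exceeds `-1` because `α + 1/p > 0`.
  choose v hvc hvcl hvu using fun n : ℕ =>
    (fun (hN : ∃ N : ℝ, ∀ s, ‖U (e n) s‖ ≤ N) =>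
      hT.exists_continuousOn_eq_convB_of_bounded (by linarith) hd hc hS (hUm (e n) (he0 n))
        hN.choose_spec) (hUb (e n) (he0 n))
  have hsub : ∀ n, wLpNorm (p / 2) (2 * α) η (fun s => U (e n) s - u s) ≤
      ENNReal.ofReal (e n) := fun n => by
    refine le_trans (le_of_eq ?_) (hUε (e n) (he0 n))
    rw [wLpNorm, wLpNorm, ← eLpNorm_neg]
    congr 1
    ext t
    simp [smul_sub]
  have hint : ∀ t ∈ halfOpenTime η, ∀ f : ℝ → W, MemWLp (p / 2) (2 * α) η f →
      IntegrableOn f (Ioc 0 t) := fun t ht f hf => by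
    obtain ⟨c, hc⟩ := exists_eLpNorm_one_le (E := W) hq hqα ht.1
    exact (hc η f ht.2 hf).1
  have hclose : ∀ m n, ∀ t ∈ halfOpenTime η, ‖v m t - v n t‖ ≤ M * (e m + e n) := by
    intro m n t ht
    refine hT.norm_le_of_embed_eq_convB (v := fun t => v m t - v n t) hM hη hητ
      ((hUw _ (he0 m)).sub (hUw _ (he0 n)))
      (((hvc m).sub (hvc n)).mono fun t ht => ht.1) (fun t ht => ?_)
      (mul_nonneg M.coe_nonneg (add_nonneg (he0 m).le (he0 n).le)) ?_ ht
    · rw [map_sub, hvu m t ht.1, hvu n t ht.1,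
        hT.convB_sub ht.1 (hint t ht _ (hUw _ (he0 m))) (hint t ht _ (hUw _ (he0 n)))]
    · rw [ENNReal.ofReal_mul M.coe_nonneg, ENNReal.ofReal_coe_nnreal,
        ENNReal.ofReal_add (he0 m).le (he0 n).le]
      gcongr
      have h1 : (fun s => U (e m) s - U (e n) s) =
          fun s => (U (e m) s - u s) + (u s - U (e n) s) := by
        ext s; abel
      rw [h1]
      exact (wLpNorm_add_le hq.le ((hUw _ (he0 m)).sub hu) (hu.sub (hUw _ (he0 n)))).trans
        (add_le_add (hsub m) (hUε _ (he0 n)))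
  have hcauchy : UniformCauchySeqOn v atTop (halfOpenTime η) := by
    rw [Metric.uniformCauchySeqOn_iff]
    intro ε hε
    obtain ⟨N, hN⟩ := (het.const_mul (2 * (M : ℝ))).eventually
      (gt_mem_nhds (show 2 * (M : ℝ) * 0 < ε by simpa using hε)) |>.exists
    refine ⟨N, fun m hm n hn t ht => ?_⟩
    rw [dist_eq_norm]
    have hanti : ∀ k, N ≤ k → e k ≤ e N := fun k hk => by
      simp only [he]
      gcongr
    calc ‖v m t - v n t‖ ≤ M * (e m + e n) := hclose m n t ht
      _ ≤ M * (e N + e N) := by gcongr <;> apply hanti <;> assumption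
      _ = 2 * M * e N := by ring
      _ < ε := hN
  have hlim : ∀ t ∈ halfOpenTime η, ∃ x, Tendsto (fun n => v n t) atTop (𝓝 x) := fun t ht =>
    cauchySeq_tendsto_of_complete (hcauchy.cauchySeq ht)
  choose! V hV using hlim
  have hunif := hcauchy.tendstoUniformlyOn_of_tendsto hV
  refine ⟨V, hunif.continuousOn (Frequently.of_forall fun n => (hvc n).mono fun t ht => ht.1),
    fun t ht => isClosed_closure.mem_of_tendsto (hV t ht)
      (Eventually.of_forall fun n => hvcl n t ht.1), fun t ht => ?_⟩
  have h1 : Tendsto (fun n => embed A (v n t)) atTop (𝓝 (embed A (V t))) :=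
    ((embed A).continuous.tendsto _).comp (hV t ht)
  -- The limit is identified in `X₋₁`: there the convolution is controlled by the `L¹(0, t)` norm of
  -- `U (e n) - u`, which the weighted norm dominates.
  refine tendsto_nhds_unique h1 ?_
  obtain ⟨M', hM', hTM⟩ := hT.exists_orbit_convolution_le (B := B)
  obtain ⟨c', hc'⟩ := exists_eLpNorm_one_le (E := W) hq hqα ht.1
  rw [tendsto_iff_norm_sub_tendsto_zero]
  refine squeeze_zero (g := fun n => M' * (c' * e n)) (fun _ => norm_nonneg _) (fun n => ?_) ?_
  · have hsubm := (hUw _ (he0 n)).sub hu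
    rw [hvu n t ht.1, ← hT.convB_sub ht.1 (hint t ht _ (hUw _ (he0 n))) (hint t ht _ hu), convB_eq,
      LinearIsometryEquiv.norm_map]
    refine (hTM _ t ht.1 (hint t ht _ hsubm)).2.trans ?_
    gcongr
    refine ENNReal.toReal_le_of_le_ofReal (mul_nonneg c'.coe_nonneg (he0 n).le) ?_
    rw [ENNReal.ofReal_mul c'.coe_nonneg, ENNReal.ofReal_coe_nnreal]
    refine (hc' η _ ht.2 hsubm).2.trans ?_
    gcongr
    exact hsub n
  · simpa using (het.const_mul (c' : ℝ)).const_mul M'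

end GeneratesBoundedAnalyticSemigroup

end AbstractKato

/-! ### Passing `C` through the convolution, and vanishing of weighted norms at zero. -/

namespace AbstractKato

open Filter Topology

variable {X Z W : Type*} [NormedAddCommGroup X] [NormedSpace ℂ X] [CompleteSpace X]
  [NormedAddCommGroup Z] [NormedSpace ℂ Z] [NormedAddCommGroup W] [NormedSpace ℂ W]
  {A : X →ₗ.[ℂ] X} {T : ℝ → X →L[ℂ] X} {C : X →ₗ.[ℂ] Z} {B : W →L[ℂ] Extrap A}
  {p : ℝ≥0∞} {α : ℝ} {τ η : EReal} {u : ℝ → W} {L : X →L[ℂ] Z} {v : ℝ → X}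

lemma shiftedSemigroupSq_shiftInv (hT : GeneratesBoundedAnalyticSemigroup A T) {t : ℝ}
    (ht : 0 < t) (x : X) : shiftedSemigroupSq T t (shiftInv A x) = shiftedSemigroup T t x := by
  apply hT.shiftInv_injective
  rw [shiftInv_shiftedSemigroupSq hT ht, hT.shiftedSemigroup_shiftInv ht,
    hT.shiftInv_shiftedSemigroup ht]

/-- Stopping at `t - δ` stays away from the singularity, so `CT(δ)` acts through the bounded
operator `L(I+A)²T(δ)` on the integral representing `(I+A)⁻¹z` and may be taken inside. -/
lemma comp_shiftedSemigroup_eq_integral_kernelCB [CompleteSpace Z]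
    (hT : GeneratesBoundedAnalyticSemigroup A T)
    (hL : ∀ x, L x = app C (shiftInv A x)) {δ t : ℝ} (hδ : 0 < δ) (hδt : δ ≤ t)
    (hu : IntegrableOn u (Ioc 0 (t - δ))) {z : X} (hz : embed A z = convB A T B u (t - δ)) :
    L (shiftedSemigroup T δ z) = ∫ s in (0 : ℝ)..(t - δ), kernelCB A T B C (t - s) (u s) := by
  have ht : 0 ≤ t - δ := by linarith
  obtain ⟨M, -, hM⟩ := hT.exists_orbit_convolution_le (B := B)
  rw [embed_eq_convB_iff] at hz
  rw [← shiftedSemigroupSq_shiftInv hT hδ, hz, ← ContinuousLinearMap.comp_apply,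
    ← ContinuousLinearMap.intervalIntegral_comp_comm _ (hM u _ ht hu).1]
  refine intervalIntegral.integral_congr_ae ?_
  rw [uIoc_of_le ht]
  filter_upwards [Measure.ae_ne volume (t - δ)] with s hs hsm
  have hs0 : 0 < t - δ - s := sub_pos.2 (lt_of_le_of_ne hsm.2 hs)
  rw [ContinuousLinearMap.comp_apply, shiftedSemigroupSq_map hT hδ hs0,
    show δ + (t - δ - s) = t - s by ring, kernelCB_eq hT hL B (by linarith)]

/-- The closed operator `C` may be pulled into the convolution. -/
lemma mem_domain_and_app_eq_convCB [CompleteSpace Z] (hT : GeneratesBoundedAnalyticSemigroup A T)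
    (hC : C.IsClosed) (hdom : A.domain ≤ C.domain) (hL : ∀ x, L x = app C (shiftInv A x))
    (hv : ContinuousOn v (halfOpenTime η))
    (hvcl : ∀ t ∈ halfOpenTime η, v t ∈ closure (A.domain : Set X))
    (hvu : ∀ t ∈ halfOpenTime η, embed A (v t) = convB A T B u t) {t : ℝ} (ht : t ∈ openTime η)
    (hu : IntegrableOn u (Ioc 0 t))
    (hk : IntervalIntegrable (fun s => kernelCB A T B C (t - s) (u s)) volume 0 t) :
    v t ∈ C.domain ∧ app C (v t) = convCB A T B C u t := by
  obtain ⟨M, hM, hTM⟩ := hT.exists_norm_le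
  have ht0 : 0 < t := ht.1
  have hmem : ∀ᶠ δ in 𝓝[>] (0 : ℝ), 0 < δ ∧ δ ≤ t := by
    filter_upwards [self_mem_nhdsWithin, nhdsWithin_le_nhds (Iic_mem_nhds ht0)] with δ h1 h2
      using ⟨h1, h2⟩
  have hhalf : ∀ δ, 0 < δ → δ ≤ t → t - δ ∈ halfOpenTime η := fun δ h1 h2 =>
    ⟨by linarith, lt_of_le_of_lt (EReal.coe_le_coe_iff.2 (by linarith)) ht.2⟩
  have hsubt : Tendsto (fun δ : ℝ => t - δ) (𝓝[>] 0) (𝓝 t) := by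
    have : Tendsto (fun δ : ℝ => t - δ) (𝓝 0) (𝓝 (t - 0)) := tendsto_const_nhds.sub tendsto_id
    rw [sub_zero] at this
    exact this.mono_left nhdsWithin_le_nhds
  have hvt : Tendsto (fun δ : ℝ => v (t - δ)) (𝓝[>] 0) (𝓝 (v t)) := by
    refine (hv t (openTime_subset_halfOpenTime ht)).tendsto.comp
      (tendsto_nhdsWithin_iff.2 ⟨hsubt, ?_⟩)
    filter_upwards [hmem] with δ hδ using hhalf δ hδ.1 hδ.2
  -- Both the argument and the operator vary with `δ`: uniform boundedness handles the first, and
  -- strong continuity, valid because `v t` lies in the closure of the domain, the second.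
  have h1 : Tendsto (fun δ => T δ (v (t - δ))) (𝓝[>] 0) (𝓝 (v t)) := by
    have h2 : Tendsto (fun δ => T δ (v (t - δ) - v t)) (𝓝[>] 0) (𝓝 0) := by
      refine squeeze_zero_norm' (a := fun δ => M * ‖v (t - δ) - v t‖) ?_ ?_
      · filter_upwards [hmem] with δ hδ using (T δ).le_of_opNorm_le (hTM δ hδ.1.le) _
      · simpa using ((tendsto_iff_norm_sub_tendsto_zero.1 hvt).const_mul M)
    have h3 : Tendsto (fun δ => T δ (v t)) (𝓝[>] 0) (𝓝 (v t)) :=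
      (hT.tendsto_nhdsWithin_zero (hvcl t (openTime_subset_halfOpenTime ht))).mono_left
        (nhdsWithin_mono _ Ioi_subset_Ici_self)
    have h4 := h2.add h3
    simp only [map_sub, sub_add_cancel, zero_add] at h4
    exact h4
  have h2 : Tendsto (fun δ => app C (T δ (v (t - δ)))) (𝓝[>] 0) (𝓝 (convCB A T B C u t)) := by
    have h3 : ContinuousOn (fun r => ∫ s in (0 : ℝ)..r, kernelCB A T B C (t - s) (u s))
        (uIcc 0 t) := intervalIntegral.continuousOn_primitive_interval' hk left_mem_uIcc
    rw [uIcc_of_le ht0.le] at h3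
    have h4 : Tendsto (fun δ => ∫ s in (0 : ℝ)..(t - δ), kernelCB A T B C (t - s) (u s)) (𝓝[>] 0)
        (𝓝 (∫ s in (0 : ℝ)..t, kernelCB A T B C (t - s) (u s))) := by
      refine (h3 t (right_mem_Icc.2 ht0.le)).tendsto.comp (tendsto_nhdsWithin_iff.2 ⟨hsubt, ?_⟩)
      filter_upwards [hmem] with δ hδ using ⟨by linarith [hδ.2], by linarith [hδ.1]⟩
    refine h4.congr' ?_
    filter_upwards [hmem] with δ hδ
    rw [app_semigroup hT hL hδ.1, comp_shiftedSemigroup_eq_integral_kernelCB hT hL hδ.1 hδ.2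
      (hu.mono_set (Ioc_subset_Ioc_right (by linarith [hδ.1]))) (hvu _ (hhalf δ hδ.1 hδ.2))]
  have hgraph : (v t, convCB A T B C u t) ∈ C.graph := by
    refine hC.mem_of_tendsto (h1.prodMk_nhds h2) ?_
    filter_upwards [hmem] with δ hδ
    have hd : T δ (v (t - δ)) ∈ C.domain := hdom (hT.map_mem_domain hδ.1 _)
    rw [app_of_mem hd]
    exact C.mem_graph ⟨_, hd⟩
  obtain ⟨y, hy1, hy2⟩ := (LinearPMap.mem_graph_iff C).1 hgraph
  simp only at hy1 hy2
  have hyd : v t ∈ C.domain := hy1 ▸ y.2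
  refine ⟨hyd, ?_⟩
  rw [app_of_mem hyd, ← hy2]
  congr 1
  exact Subtype.ext hy1.symm

/-- Split `x₀` into a small remainder, controlled by [A1], and `z = (I+A)⁻¹y`. For the latter
`CT(t)z = L T(t)y` is bounded, so its norm on `(0, h)` is of order `h^(α+1/p)`. -/
lemma tendsto_wLpNorm_orbit (hT : GeneratesBoundedAnalyticSemigroup A T)
    (hdom : A.domain ≤ C.domain) (hL : ∀ x, L x = app C (shiftInv A x)) (hτ : 0 < τ)
    (hp : 1 ≤ p) (hα : 0 ≤ α) (hαp0 : 0 < α + (p⁻¹).toReal) (hA1 : ConditionA1 T C p α τ)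
    {x₀ : X} (hx₀ : x₀ ∈ closure (A.domain : Set X)) :
    Tendsto (fun h : ℝ => wLpNorm p α h (fun t => app C (T t x₀))) (𝓝[>] 0) (𝓝 0) := by
  obtain ⟨M, hM⟩ := hA1
  obtain ⟨M', hM', hTM⟩ := hT.exists_norm_le
  obtain ⟨h₀, hh₀, hh₀τ⟩ := exists_real_lt hτ
  rw [ENNReal.tendsto_nhds_zero]
  intro ε hε
  obtain ⟨ε', hε', hε'ε⟩ := ENNReal.lt_iff_exists_nnreal_btwn.1 hε
  have hε'0 : 0 < (ε' : ℝ) := by exact_mod_cast hε'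
  obtain ⟨z, hz, hxz⟩ := Metric.mem_closure_iff.1 hx₀ (ε' / (2 * (M + 1))) (by positivity)
  obtain ⟨y, rfl⟩ := hT.isInverseOfShift.exists_eq hz
  set z := shiftInv A y
  have hlim : Tendsto (fun h : ℝ => h ^ (α + p.toReal⁻¹) * (‖L‖ * (M' * ‖y‖))) (𝓝[>] 0)
      (𝓝 0) := by
    rw [ENNReal.toReal_inv] at hαp0
    have h1 : ContinuousAt (fun h : ℝ => h ^ (α + p.toReal⁻¹)) 0 :=
      Real.continuousAt_rpow_const _ _ (Or.inr hαp0.le)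
    have h2 := h1.tendsto
    rw [Real.zero_rpow hαp0.ne'] at h2
    simpa using (h2.mono_left nhdsWithin_le_nhds).mul_const (‖L‖ * (M' * ‖y‖))
  filter_upwards [hlim.eventually (gt_mem_nhds (half_pos hε'0)), self_mem_nhdsWithin,
    nhdsWithin_le_nhds (Iic_mem_nhds hh₀)] with h h1 h2 h3
  have h2' : (0 : ℝ) < h := h2
  have hle : (h : EReal) ≤ τ := (EReal.coe_le_coe_iff.2 h3).trans hh₀τ.le
  have heq : (fun t => app C (T t x₀)) =ᵐ[volume.restrict (openTime (h : EReal))]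
      fun t => app C (T t (x₀ - z)) + app C (T t z) := by
    filter_upwards [ae_openTime (h : EReal)] with t ht
    rw [← app_add (hdom (hT.map_mem_domain ht.1 _)) (hdom (hT.map_mem_domain ht.1 _)), ← map_add,
      sub_add_cancel]
  rw [wLpNorm_congr heq]
  refine (wLpNorm_add_le hp ((hM _).1.mono hle) ((hM _).1.mono hle)).trans ?_
  refine le_trans ?_ hε'ε.le
  rw [← ENNReal.ofReal_coe_nnreal, ← add_halves (ε' : ℝ),
    ENNReal.ofReal_add (by positivity) (by positivity)]
  refine add_le_add ?_ ?_
  · refine ((wLpNorm_mono hle).trans (hM _).2).trans ?_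
    rw [← ofReal_norm, ← ENNReal.ofReal_coe_nnreal, ← ENNReal.ofReal_mul M.coe_nonneg]
    refine ENNReal.ofReal_le_ofReal ?_
    rw [dist_eq_norm, lt_div_iff₀ (by positivity)] at hxz
    have := norm_nonneg (x₀ - z)
    nlinarith
  · refine (wLpNorm_le_of_norm_le hα h2' (D := ‖L‖ * (M' * ‖y‖)) ?_).trans
      (ENNReal.ofReal_le_ofReal h1.le)
    intro t ht
    rw [← hT.shiftInv_map t ht.1.le, ← hL]
    exact L.le_opNorm_of_le ((T t).le_of_opNorm_le (hTM t ht.1.le) y)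

lemma tendsto_wLpNorm_zero_of_ne_top {f : ℝ → Z} (hp : 1 ≤ p) (hp' : p ≠ ∞) (hη : 0 < η)
    (hf : MemWLp p α η f) : Tendsto (fun h : ℝ => wLpNorm p α h f) (𝓝[>] 0) (𝓝 0) := by
  obtain ⟨h₀, hh₀, hh₀τ⟩ := exists_real_lt hη
  rw [ENNReal.tendsto_nhds_zero]
  intro ε hε
  obtain ⟨ε', hε', hε'ε⟩ := ENNReal.lt_iff_exists_nnreal_btwn.1 hε
  have hε'0 : 0 < (ε' : ℝ) := by exact_mod_cast hε'
  obtain ⟨δ, hδ, hδε⟩ := hf.eLpNorm_indicator_le hp hp' hε'0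
  filter_upwards [self_mem_nhdsWithin, nhdsWithin_le_nhds (Iic_mem_nhds hh₀),
    nhdsWithin_le_nhds (Iic_mem_nhds hδ)] with h h1 h2 h3
  have hle : (h : EReal) ≤ η := (EReal.coe_le_coe_iff.2 h2).trans hh₀τ.le
  have h4 := hδε (openTime (h : EReal)) (measurableSet_openTime _) (by
    refine (Measure.restrict_apply_le _ _).trans ?_
    rw [openTime_coe, Real.volume_Ioo, sub_zero]
    exact ENNReal.ofReal_le_ofReal h3)
  rw [ENNReal.ofReal_coe_nnreal] at h4
  rw [eLpNorm_indicator_eq_eLpNorm_restrict (measurableSet_openTime _),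
    Measure.restrict_restrict (measurableSet_openTime _),
    inter_eq_self_of_subset_left (openTime_mono hle)] at h4
  exact h4.trans hε'ε.le

/-! ### The endpoint case `p = ∞`. -/

section Endpoint

lemma MemWLp.ae_norm_le {f : ℝ → Z} (hf : MemWLp ∞ α η f) :
    ∃ N : ℝ, 0 ≤ N ∧ ∀ᵐ t ∂(volume.restrict (openTime η)), ‖f t‖ ≤ N * t ^ (-α) := by
  refine ⟨(wLpNorm ∞ α η f).toReal, ENNReal.toReal_nonneg, ?_⟩
  have h1 := eLpNorm_top_ae_le (v := fun t : ℝ => t ^ α • f t)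
    (μ := volume.restrict (openTime η)) (c := (wLpNorm ∞ α η f).toReal) ENNReal.toReal_nonneg
    (by rw [ENNReal.ofReal_toReal hf.wLpNorm_lt_top.ne, wLpNorm])
  filter_upwards [h1, ae_openTime η] with t ht ht0
  have htα : 0 < t ^ α := Real.rpow_pos_of_pos ht0.1 _
  rw [norm_smul, Real.norm_of_nonneg htα.le] at ht
  rw [Real.rpow_neg ht0.1.le, ← div_eq_mul_inv, le_div_iff₀ htα]
  linarith

lemma exists_norm_comp_shiftedSemigroup_le (hT : GeneratesBoundedAnalyticSemigroup A T)
    (hL : ∀ x, L x = app C (shiftInv A x)) (hA1 : ConditionA1 T C ∞ α τ) :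
    ∃ M : ℝ, 0 ≤ M ∧ ∀ t ∈ openTime τ, ∀ x, ‖L (shiftedSemigroup T t x)‖ ≤ M * t ^ (-α) * ‖x‖ := by
  obtain ⟨M, hM⟩ := hA1
  refine ⟨M, M.coe_nonneg, fun t ht x => ?_⟩
  have h1 : ∀ᵐ t ∂(volume.restrict (openTime τ)), ‖t ^ α • app C (T t x)‖ ≤ M * ‖x‖ := by
    refine eLpNorm_top_ae_le (by positivity) ((hM x).2.trans_eq ?_)
    rw [ENNReal.ofReal_mul M.coe_nonneg, ENNReal.ofReal_coe_nnreal, ofReal_norm]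
  have hcont : ContinuousOn (fun t : ℝ => ‖t ^ α • L (shiftedSemigroup T t x)‖) (openTime τ) := by
    refine ContinuousOn.norm (ContinuousOn.smul (f := fun t : ℝ => t ^ α) ?_ ?_)
    · exact fun s hs => (Real.continuousAt_rpow_const _ _ (Or.inl hs.1.ne')).continuousWithinAt
    · exact L.continuous.comp_continuousOn
        ((hT.continuousOn_shiftedSemigroup.mono fun s hs => hs.1).clm_apply continuousOn_const)
  have h2 := le_of_ae_le_of_continuousOn (isOpen_openTime τ) hcont (c := M * ‖x‖) (by
    filter_upwards [h1, ae_openTime τ] with s hs hs0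
    rwa [← app_semigroup hT hL hs0.1]) ht
  have htα : 0 < t ^ α := Real.rpow_pos_of_pos ht.1 _
  rw [norm_smul, Real.norm_of_nonneg htα.le] at h2
  rw [Real.rpow_neg ht.1.le, mul_right_comm, ← div_eq_mul_inv, le_div_iff₀ htα]
  linarith

/-- Split the time in two halves: `CT(t/2)` costs `t^(-α)` by [A1] and `(I+A)T(t/2)(I+A₋₁)⁻¹B` costs
`t^(2α-1)`, together `t^(α-1)`. -/
lemma exists_norm_kernelCB_le (hT : GeneratesBoundedAnalyticSemigroup A T)
    (hL : ∀ x, L x = app C (shiftInv A x)) (hτ : 0 < τ) (hα : 0 ≤ α) (hα2 : α < 1 / 2)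
    (hA1 : ConditionA1 T C ∞ α τ) (hA2 : ConditionA2 A T B ∞ α τ) :
    ∃ h c : ℝ, 0 < h ∧ (h : EReal) < τ ∧ 0 ≤ c ∧ ∀ t, 0 < t → t ≤ h → ∀ w,
      ‖kernelCB A T B C t w‖ ≤ c * t ^ (α - 1) * ‖w‖ := by
  obtain ⟨h, c, hh, hhτ, hc, hS⟩ :=
    hT.exists_shiftedSemigroup_baseMap_le_near_zero hτ hα (by simpa using hα2) hA2
  obtain ⟨M, hM, hLM⟩ := exists_norm_comp_shiftedSemigroup_le hT hL hA1
  refine ⟨h, M * c * (1 / 2) ^ (α - 1), hh, hhτ, by positivity, fun t ht hth w => ?_⟩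
  have h1 := hLM (t / 2) ⟨by positivity,
    lt_of_le_of_lt (EReal.coe_le_coe_iff.2 (by linarith)) hhτ⟩
      (shiftedSemigroup T (t / 2) (baseMap A B w))
  have h2 := ((shiftedSemigroup T (t / 2)).comp (baseMap A B)).le_of_opNorm_le
    (hS (t / 2) (by positivity) (by linarith)) w
  rw [ContinuousLinearMap.comp_apply] at h2
  rw [kernelCB_eq hT hL B ht, shiftedSemigroupSq, ContinuousLinearMap.comp_apply]
  refine (h1.trans (mul_le_mul_of_nonneg_left h2 (by positivity))).trans_eq ?_
  have h3 : (t / 2) ^ (α - 1) = (1 / 2) ^ (α - 1) * t ^ (α - 1) := by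
    rw [← Real.mul_rpow (by norm_num) ht.le]; congr 1; ring
  have h4 : (t / 2) ^ (-α) * (t / 2) ^ (2 * α + 2 * ((∞ : ℝ≥0∞)⁻¹).toReal - 1) =
      (t / 2) ^ (α - 1) := by
    rw [← Real.rpow_add (by positivity)]
    congr 1
    simp
    ring
  rw [mul_assoc _ _ (t ^ (α - 1)), ← h3, ← h4]
  ring

/-- In the case `p = ∞`, continuity of the convolution in `X` at time `0` forces the weighted norms
of its image under `C` to vanish at time `0`. -/
lemma tendsto_wLpNorm_convCB_of_top [CompleteSpace Z] (hT : GeneratesBoundedAnalyticSemigroup A T)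
    (hL : ∀ x, L x = app C (shiftInv A x)) (hα0 : 0 < α) (hα2 : α < 1 / 2)
    (hA1 : ConditionA1 T C ∞ α τ) (hA2 : ConditionA2 A T B ∞ α τ) (hη : 0 < η) (hητ : η ≤ τ)
    (hv : ContinuousOn v (halfOpenTime η))
    (hvu : ∀ t ∈ halfOpenTime η, embed A (v t) = convB A T B u t)
    (hu : MemWLp ∞ (2 * α) η u)
    (hk : ∀ᵐ t ∂(volume.restrict (openTime η)),
      IntervalIntegrable (fun s => kernelCB A T B C (t - s) (u s)) volume 0 t) :
    Tendsto (fun h : ℝ => wLpNorm ∞ α h (convCB A T B C u)) (𝓝[>] 0) (𝓝 0) := by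
  obtain ⟨h₁, c, hh₁, hh₁τ, hc, hK⟩ :=
    exists_norm_kernelCB_le hT hL (hη.trans_le hητ) hα0.le hα2 hA1 hA2
  obtain ⟨M, hM, hLM⟩ := exists_norm_comp_shiftedSemigroup_le hT hL hA1
  obtain ⟨N, hN, huN⟩ := hu.ae_norm_le
  obtain ⟨h₂, hh₂, hh₂η⟩ := exists_real_lt hη
  have hint : ∀ t ∈ openTime η, IntegrableOn u (Ioc 0 t) := fun t ht => by
    obtain ⟨c', hc'⟩ := exists_eLpNorm_one_le (E := W) (q := ∞) (γ := 2 * α) ENNReal.one_lt_top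
      (by simp; linarith) ht.1.le
    exact (hc' η u ht.2 hu).1
  have hv0 : v 0 = 0 := embed_injective hT (by
    rw [hvu 0 (zero_mem_halfOpenTime hη), convB_zero, map_zero])
  -- Cut the integral at `t - θt`. The early part is `CT(θt)v(t-θt)`. In the late part `s ≥ t/2`, so
  -- `u` is at most a multiple of `t^(-2α)` and the kernel contributes `(θt)^α/α`. All powers of `t`
  -- cancel against the weight, so `θ` can be fixed first to make the late part small; then `v → v 0
  -- = 0` handles the early one.
  have hsplit : ∀ θ : ℝ, 0 < θ → θ ≤ 1 / 2 → ∀ t ∈ openTime η, t ≤ h₁ →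
      IntervalIntegrable (fun s => kernelCB A T B C (t - s) (u s)) volume 0 t →
      t ^ α * ‖convCB A T B C u t‖ ≤
        M * θ ^ (-α) * ‖v (t - θ * t)‖ + c * N * (1 / 2) ^ (-(2 * α)) / α * θ ^ α := by
    intro θ hθ hθ2 t ht hth hkt
    have ht0 : 0 < t := ht.1
    have hδ : 0 < θ * t := by positivity
    have hδt : θ * t ≤ t / 2 := by nlinarith
    have hmem : t - θ * t ∈ halfOpenTime η :=
      ⟨by linarith, lt_of_le_of_lt (EReal.coe_le_coe_iff.2 (by linarith)) ht.2⟩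
    have hk1 : IntervalIntegrable (fun s => kernelCB A T B C (t - s) (u s)) volume 0 (t - θ * t) :=
      hkt.mono_set (by
        rw [uIcc_of_le hmem.1, uIcc_of_le ht0.le]; exact Icc_subset_Icc_right (by linarith))
    have hk2 : IntervalIntegrable (fun s => kernelCB A T B C (t - s) (u s)) volume (t - θ * t) t :=
      hkt.mono_set (by
        rw [uIcc_of_le (by linarith), uIcc_of_le ht0.le]; exact Icc_subset_Icc_left hmem.1)
    have h1 : ‖∫ s in (0 : ℝ)..(t - θ * t), kernelCB A T B C (t - s) (u s)‖ ≤
        M * (θ * t) ^ (-α) * ‖v (t - θ * t)‖ := by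
      rw [← comp_shiftedSemigroup_eq_integral_kernelCB hT hL hδ (by linarith)
        ((hint t ht).mono_set (Ioc_subset_Ioc_right (by linarith))) (hvu _ hmem)]
      exact hLM _ ⟨hδ, lt_of_le_of_lt (EReal.coe_le_coe_iff.2 (by linarith)) hh₁τ⟩ _
    have h2 : ‖∫ s in (t - θ * t)..t, kernelCB A T B C (t - s) (u s)‖ ≤
        c * (N * (t / 2) ^ (-(2 * α))) * ((θ * t) ^ α / α) := by
      have hb : IntervalIntegrable
          (fun s : ℝ => c * (N * (t / 2) ^ (-(2 * α))) * (t - s) ^ (α - 1)) volume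
          (t - θ * t) t := by
        have := ((intervalIntegral.intervalIntegrable_rpow' (a := 0) (b := θ * t)
          (show -1 < α - 1 by linarith)).comp_sub_left t).symm
        simpa using this.const_mul (c * (N * (t / 2) ^ (-(2 * α))))
      refine (intervalIntegral.norm_integral_le_of_norm_le (by linarith) ?_ hb).trans_eq ?_
      · have huN' := ae_restrict_Ioc_of_ae_openTime ht.2 huN
        rw [ae_restrict_iff' measurableSet_Ioc] at huN'
        filter_upwards [Measure.ae_ne volume t, huN'] with s hs hsN hsm
        have hst : 0 < t - s := sub_pos.2 (lt_of_le_of_ne hsm.2 hs)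
        have hs2 : t / 2 ≤ s := by linarith [hsm.1]
        refine (hK (t - s) hst (by linarith) _).trans ?_
        have h3 : ‖u s‖ ≤ N * (t / 2) ^ (-(2 * α)) := by
          refine (hsN ⟨by linarith, hsm.2⟩).trans ?_
          gcongr ?_ * ?_
          exact Real.rpow_le_rpow_of_nonpos (by positivity) hs2 (by linarith)
        rw [mul_right_comm]
        gcongr
      · rw [intervalIntegral.integral_const_mul,
          intervalIntegral.integral_comp_sub_left (fun r : ℝ => r ^ (α - 1)) t, sub_self,
          sub_sub_cancel, integral_rpow (Or.inl (by linarith)), sub_add_cancel,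
          Real.zero_rpow hα0.ne', sub_zero]
    have h3 : convCB A T B C u t = (∫ s in (0 : ℝ)..(t - θ * t), kernelCB A T B C (t - s) (u s)) +
        ∫ s in (t - θ * t)..t, kernelCB A T B C (t - s) (u s) :=
      (intervalIntegral.integral_add_adjacent_intervals hk1 hk2).symm
    have htα : 0 < t ^ α := Real.rpow_pos_of_pos ht0 _
    have h4 : t ^ α * (θ * t) ^ (-α) = θ ^ (-α) := by
      rw [Real.mul_rpow hθ.le ht0.le, mul_left_comm, ← Real.rpow_add ht0, add_neg_cancel,
        Real.rpow_zero, mul_one]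
    have h5 : t ^ α * ((t / 2) ^ (-(2 * α)) * (θ * t) ^ α) = (1 / 2) ^ (-(2 * α)) * θ ^ α := by
      rw [Real.mul_rpow hθ.le ht0.le, show t / 2 = (1 / 2) * t by ring,
        Real.mul_rpow (by norm_num) ht0.le]
      have h6 : t ^ α * t ^ α * t ^ (-(2 * α)) = 1 := by
        rw [← Real.rpow_add ht0, ← Real.rpow_add ht0, ← two_mul, add_neg_cancel, Real.rpow_zero]
      linear_combination (1 / 2 : ℝ) ^ (-(2 * α)) * θ ^ α * h6
    rw [h3]
    calc _ ≤ t ^ α * (M * (θ * t) ^ (-α) * ‖v (t - θ * t)‖ +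
          c * (N * (t / 2) ^ (-(2 * α))) * ((θ * t) ^ α / α)) := by
            gcongr
            exact (norm_add_le _ _).trans (add_le_add h1 h2)
      _ = _ := by
        rw [← h4]
        have h6 : c * N * (1 / 2) ^ (-(2 * α)) / α * θ ^ α =
            c * N / α * ((1 / 2) ^ (-(2 * α)) * θ ^ α) := by ring
        rw [h6, ← h5]
        ring
  rw [ENNReal.tendsto_nhds_zero]
  intro ε hε
  obtain ⟨ε', hε', hε'ε⟩ := ENNReal.lt_iff_exists_nnreal_btwn.1 hε
  have hε'0 : 0 < (ε' : ℝ) := by exact_mod_cast hε'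
  obtain ⟨θ, hθε, hθ0, hθ2⟩ : ∃ θ : ℝ,
      c * N * (1 / 2) ^ (-(2 * α)) / α * θ ^ α < ε' / 2 ∧ 0 < θ ∧ θ ≤ 1 / 2 := by
    have h1 : ContinuousAt (fun θ : ℝ => c * N * (1 / 2) ^ (-(2 * α)) / α * θ ^ α) 0 :=
      (Real.continuousAt_rpow_const _ _ (Or.inr hα0.le)).const_mul _
    have h2 := h1.tendsto
    rw [Real.zero_rpow hα0.ne', mul_zero] at h2
    exact (((h2.mono_left nhdsWithin_le_nhds).eventually (gt_mem_nhds (half_pos hε'0))).and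
      (Filter.Eventually.and self_mem_nhdsWithin
        (nhdsWithin_le_nhds (Iic_mem_nhds (half_pos one_pos))))).exists (f := 𝓝[>] (0 : ℝ))
  have hvlim : ∀ᶠ t in 𝓝[halfOpenTime η] 0, M * θ ^ (-α) * ‖v t‖ < ε' / 2 := by
    have h1 : Tendsto (fun t => M * θ ^ (-α) * ‖v t‖) (𝓝[halfOpenTime η] 0) (𝓝 0) := by
      have := ((hv 0 (zero_mem_halfOpenTime hη)).tendsto.norm).const_mul (M * θ ^ (-α))
      simpa [hv0] using this
    exact h1.eventually (gt_mem_nhds (half_pos hε'0))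
  obtain ⟨r, hr, hrv⟩ := Metric.mem_nhdsWithin_iff.1 hvlim
  filter_upwards [self_mem_nhdsWithin, nhdsWithin_le_nhds (Iic_mem_nhds hh₁),
    nhdsWithin_le_nhds (Iic_mem_nhds hh₂), nhdsWithin_le_nhds (Iic_mem_nhds hr)] with h h3 h4 h5 h6
  have hle : (h : EReal) ≤ η := (EReal.coe_le_coe_iff.2 h5).trans hh₂η.le
  have hbound : ∀ᵐ t ∂(volume.restrict (openTime (h : EReal))),
      ‖t ^ α • convCB A T B C u t‖ ≤ ε' := by
    filter_upwards [ae_openTime_mono hle hk, ae_openTime (h : EReal)] with t h7 h8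
    have h9 := h8
    rw [openTime_coe] at h9
    have hθt : 0 < θ * t := mul_pos hθ0 h9.1
    have hθt' : θ * t ≤ t := by nlinarith [h9.1]
    have h10 := hsplit θ hθ0 hθ2 t (openTime_mono hle h8) (h9.2.le.trans h4) h7
    have h11 : M * θ ^ (-α) * ‖v (t - θ * t)‖ < ε' / 2 := hrv ⟨by
      rw [Metric.mem_ball, dist_zero_right, Real.norm_of_nonneg (by linarith)]
      have := h9.2.trans_le h6
      linarith, by linarith,
        lt_of_le_of_lt (EReal.coe_le_coe_iff.2 (by linarith)) (openTime_mono hle h8).2⟩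
    rw [norm_smul, Real.norm_of_nonneg (Real.rpow_nonneg h9.1.le _)]
    linarith
  rw [wLpNorm, eLpNorm_exponent_top]
  refine (eLpNormEssSup_le_of_ae_bound hbound).trans ?_
  rw [ENNReal.ofReal_coe_nnreal]
  exact hε'ε.le

end Endpoint

end AbstractKato

/-! ### Restarting solutions, and uniqueness. -/

namespace AbstractKato

open Filter Topology

variable {X Z W : Type*} [NormedAddCommGroup X] [NormedSpace ℂ X] [CompleteSpace X]
  [NormedAddCommGroup Z] [NormedSpace ℂ Z] [CompleteSpace Z]
  [NormedAddCommGroup W] [NormedSpace ℂ W]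
  {A : X →ₗ.[ℂ] X} {T : ℝ → X →L[ℂ] X} {C : X →ₗ.[ℂ] Z} {B : W →L[ℂ] Extrap A}
  {p : ℝ≥0∞} {α : ℝ} {τ η : EReal} {u : ℝ → W} {L : X →L[ℂ] Z} {v : ℝ → X}
  {F : Z →L[ℂ] Z →L[ℂ] W} {x₀ : X}

/-- The standing assumptions of Kato's method; `L` is the bounded operator `C (I + A)⁻¹`. -/
structure KatoSetting (A : X →ₗ.[ℂ] X) (T : ℝ → X →L[ℂ] X) (B : W →L[ℂ] Extrap A)
    (C : X →ₗ.[ℂ] Z) (L : X →L[ℂ] Z) (p : ℝ≥0∞) (α : ℝ) (τ : EReal) : Prop where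
  semigroup : GeneratesBoundedAnalyticSemigroup A T
  closed : C.IsClosed
  domain_le : A.domain ≤ C.domain
  comp_shiftInv : ∀ x, L x = app C (shiftInv A x)
  time_pos : 0 < τ
  two_lt : 2 < p
  weight_nonneg : 0 ≤ α
  exponent_pos : 0 < α + (p⁻¹).toReal
  exponent_lt : α + (p⁻¹).toReal < 1 / 2
  condA1 : ConditionA1 T C p α τ
  condA2 : ConditionA2 A T B p α τ
  condA3 : ConditionA3 A T B C p α τ

omit [CompleteSpace Z] in
-- Telescoping: `F(f,f) - F(g,g) = F(f-g,f) + F(g,f-g)`.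
lemma wLpNorm_bilin_sub_le (hp : 2 ≤ p) {f g : ℝ → Z}
    (hf : MemWLp p α η f) (hg : MemWLp p α η g) :
    wLpNorm (p / 2) (2 * α) η (fun t => F (f t) (f t) - F (g t) (g t)) ≤
      ‖F‖₊ * (wLpNorm p α η f + wLpNorm p α η g) * wLpNorm p α η (fun t => f t - g t) := by
  have hd := hf.sub hg
  have h1 := wLpNorm_bilin_le F hd hf
  have h2 := wLpNorm_bilin_le F hg hd
  have heq : (fun t => F (f t) (f t) - F (g t) (g t)) =
      fun t => F (f t - g t) (f t) + F (g t) (f t - g t) := by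
    ext t
    simp only [map_sub, sub_apply]
    abel
  have hq : 1 ≤ p / 2 := by
    rw [ENNReal.le_div_iff_mul_le (by simp) (by simp), one_mul]; exact hp
  rw [heq]
  refine ((wLpNorm_add_le hq h1.1 h2.1).trans (add_le_add h1.2 h2.2)).trans_eq ?_
  ring

lemma mem_openTime_sub_iff {t₀ t : ℝ} :
    t ∈ openTime (η - t₀) ↔ 0 < t ∧ ((t₀ + t : ℝ) : EReal) < η := by
  rw [openTime, mem_ofPred_eq, EReal.lt_sub_iff_add_lt (by simp) (by simp), add_comm t₀ t,
    EReal.coe_add]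

lemma mem_halfOpenTime_sub_iff {t₀ t : ℝ} :
    t ∈ halfOpenTime (η - t₀) ↔ 0 ≤ t ∧ ((t₀ + t : ℝ) : EReal) < η := by
  rw [halfOpenTime, mem_ofPred_eq, EReal.lt_sub_iff_add_lt (by simp) (by simp), add_comm t₀ t,
    EReal.coe_add]

lemma ae_openTime_shift {t₀ : ℝ} (ht₀ : 0 ≤ t₀) {P : ℝ → Prop}
    (h : ∀ᵐ t ∂(volume.restrict (openTime η)), P t) :
    ∀ᵐ t ∂(volume.restrict (openTime (η - t₀))), P (t₀ + t) := by
  rw [ae_restrict_iff' (measurableSet_openTime _)] at h ⊢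
  filter_upwards [(measurePreserving_add_left volume t₀).quasiMeasurePreserving.ae h] with t ht htm
  rw [mem_openTime_sub_iff] at htm
  exact ht ⟨by linarith [htm.1], htm.2⟩

omit [CompleteSpace Z] in
lemma MemWLp.shift {f : ℝ → Z} (hα : 0 ≤ α) (hf : MemWLp p α η f) {t₀ : ℝ} (ht₀ : 0 ≤ t₀) :
    MemWLp p α (η - t₀) (fun t => f (t₀ + t)) := by
  have hmp := (measurePreserving_add_left volume t₀).restrict_preimage
    (measurableSet_openTime η)
  have hsub : openTime (η - t₀) ⊆ (t₀ + ·) ⁻¹' openTime η := fun t ht => by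
    rw [mem_openTime_sub_iff] at ht
    exact ⟨by linarith [ht.1], ht.2⟩
  have h1 : MemLp (fun t : ℝ => (t₀ + t) ^ α • f (t₀ + t)) p
      (volume.restrict (openTime (η - t₀))) :=
    (MemLp.comp_measurePreserving (f := fun t : ℝ => t₀ + t) hf hmp).mono_measure
      (Measure.restrict_mono hsub le_rfl)
  have hm : AEStronglyMeasurable (fun t => f (t₀ + t)) (volume.restrict (openTime (η - t₀))) :=
    ((hf.aestronglyMeasurable.comp_measurePreserving hmp).mono_measure
      (Measure.restrict_mono hsub le_rfl))
  -- Restarting the clock only decreases the weight, since `t^α ≤ (t₀+t)^α` for `α ≥ 0`.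
  refine h1.mono ((aestronglyMeasurable_weight_iff (f := fun t => f (t₀ + t))).2 hm) ?_
  filter_upwards [ae_openTime (η - t₀)] with t ht
  have ht0 : 0 < t := ht.1
  rw [norm_smul, norm_smul, Real.norm_of_nonneg (by positivity), Real.norm_of_nonneg (by positivity)]
  gcongr
  linarith

omit [CompleteSpace Z] in
-- Split the integral at `t₀`; by the semigroup law the first piece is `T₋₁(t)` applied to the
-- integral up to `t₀`, and a translation treats the second.
lemma IsMildSolution.shift (hT : GeneratesBoundedAnalyticSemigroup A T) (hα : 0 ≤ α)
    (hint : ∀ u : ℝ → W, MemWLp (p / 2) (2 * α) η u → ∀ t ∈ halfOpenTime η, IntegrableOn u (Ioc 0 t))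
    {x : ℝ → X} (hx : IsMildSolution A T B C F p α x₀ η x) {t₀ : ℝ} (ht₀ : t₀ ∈ halfOpenTime η) :
    IsMildSolution A T B C F p α (x t₀) (η - t₀) (fun t => x (t₀ + t)) := by
  have hmaps : MapsTo (t₀ + ·) (halfOpenTime (η - t₀)) (halfOpenTime η) := fun t ht => by
    rw [mem_halfOpenTime_sub_iff] at ht
    exact ⟨add_nonneg ht₀.1 ht.1, ht.2⟩
  refine ⟨hx.continuousOn.comp (by fun_prop) hmaps, fun t ht => hx.mem_closure _ (hmaps ht),
    ae_openTime_shift ht₀.1 hx.mem_domain, hx.memWLp.shift hα ht₀.1, fun t ht => ?_⟩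
  have hu := (wLpNorm_bilin_le F hx.memWLp hx.memWLp).1
  set u : ℝ → W := fun s => F (app C (x s)) (app C (x s))
  obtain ⟨M, -, hM⟩ := hT.exists_orbit_convolution_le (B := B)
  have ht' := hmaps ht
  have h1 := hx.integral_eq _ ht'
  have h0 := hx.integral_eq _ ht₀
  have hi := (hM u _ ht'.1 (hint u hu _ ht')).1
  have hi0 := (hM u _ ht₀.1 (hint u hu _ ht₀)).1
  have htt : t₀ ≤ t₀ + t := le_add_of_nonneg_right ht.1
  have hi1 : IntervalIntegrable (fun s => T (t₀ + t - s) (baseMap A B (u s))) volume 0 t₀ :=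
    hi.mono_set (by rw [uIcc_of_le ht₀.1, uIcc_of_le ht'.1]; exact Icc_subset_Icc_right htt)
  have hi2 : IntervalIntegrable (fun s => T (t₀ + t - s) (baseMap A B (u s))) volume t₀ (t₀ + t) :=
    hi.mono_set (by rw [uIcc_of_le htt, uIcc_of_le ht'.1]; exact Icc_subset_Icc_left ht₀.1)
  simp only [embed_apply, convB_eq, ← map_add, (shiftIso A).injective.eq_iff] at h0 h1 ⊢
  rw [h1, hT.shiftInv_map t ht.1, h0, map_add (T t), hT.shiftInv_map t₀ ht₀.1,
    hT.shiftInv_map _ ht'.1, ← hT.map_add_apply ht.1 ht₀.1, add_comm t t₀, add_assoc,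
    ← ContinuousLinearMap.intervalIntegral_comp_comm _ hi0,
    ← intervalIntegral.integral_add_adjacent_intervals hi1 hi2]
  congr 2
  · refine intervalIntegral.integral_congr fun s hs => ?_
    rw [uIcc_of_le ht₀.1] at hs
    rw [← hT.map_add_apply ht.1 (sub_nonneg.2 hs.2)]
    congr 2
    ring
  · have := intervalIntegral.integral_comp_add_left
      (fun s => T (t₀ + t - s) (baseMap A B (u s))) t₀ (a := 0) (b := t)
    rw [add_zero] at this
    rw [← this]
    refine intervalIntegral.integral_congr fun s _ => ?_
    congr 2
    ring

namespace KatoSetting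

variable (K : KatoSetting A T B C L p α τ)
include K

omit [CompleteSpace X] [CompleteSpace Z] in
lemma one_le : 1 ≤ p := one_le_two.trans K.two_lt.le

omit [CompleteSpace X] [CompleteSpace Z] in
lemma integrableOn (hu : MemWLp (p / 2) (2 * α) η u) {t : ℝ} (ht : t ∈ halfOpenTime η) :
    IntegrableOn u (Ioc 0 t) := by
  obtain ⟨c, hc⟩ := exists_eLpNorm_one_le (E := W) (one_lt_half K.two_lt)
    (two_mul_add_inv_half K.exponent_lt) ht.1
  exact (hc η u ht.2 hu).1

omit [CompleteSpace X] [CompleteSpace Z] in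
/-- The estimate for the convolution on `(0, τ)` localizes to smaller intervals. -/
lemma exists_convCB_le : ∃ M : ℝ≥0, ∀ (η : EReal) (u : ℝ → W), η ≤ τ →
    MemWLp (p / 2) (2 * α) η u →
    (∀ᵐ t ∂(volume.restrict (openTime η)),
      IntervalIntegrable (fun s => kernelCB A T B C (t - s) (u s)) volume 0 t) ∧
    MemWLp p α η (convCB A T B C u) ∧
    wLpNorm p α η (convCB A T B C u) ≤ M * wLpNorm (p / 2) (2 * α) η u := by
  obtain ⟨M, hM⟩ := K.condA3
  refine ⟨M, fun η u hη hu => ?_⟩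
  obtain ⟨h1, h2, h3⟩ := hM _ ((memWLp_indicator hη).2 hu)
  rw [wLpNorm_indicator hη] at h3
  have hcongr : ∀ t ∈ openTime η, ∀ s ∈ uIoc 0 t,
      kernelCB A T B C (t - s) ((openTime η).indicator u s) = kernelCB A T B C (t - s) (u s) := by
    intro t ht s hs
    rw [uIoc_of_le ht.1.le] at hs
    rw [indicator_of_mem (Ioc_subset_openTime ht.2 hs)]
  have heq : convCB A T B C ((openTime η).indicator u) =ᵐ[volume.restrict (openTime η)]
      convCB A T B C u := by
    filter_upwards [ae_openTime η] with t ht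
    exact intervalIntegral.integral_congr_ae (Eventually.of_forall (hcongr t ht))
  refine ⟨?_, (h2.mono hη).congr heq, ?_⟩
  · filter_upwards [ae_openTime_mono hη h1, ae_openTime η] with t ht htm
    exact ht.congr (hcongr t htm)
  · rw [← wLpNorm_congr heq]
    exact (wLpNorm_mono hη).trans h3

omit [CompleteSpace Z] in
lemma convCB_sub {u' : ℝ → W} (hη : η ≤ τ) (hu : MemWLp (p / 2) (2 * α) η u)
    (hu' : MemWLp (p / 2) (2 * α) η u') :
    convCB A T B C (fun s => u s - u' s) =ᵐ[volume.restrict (openTime η)]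
      fun t => convCB A T B C u t - convCB A T B C u' t := by
  obtain ⟨M, hM⟩ := K.exists_convCB_le
  filter_upwards [(hM η u hη hu).1, (hM η u' hη hu').1, ae_openTime η] with t h1 h2 ht
  rw [convCB, convCB, convCB, ← intervalIntegral.integral_sub h1 h2]
  refine intervalIntegral.integral_congr_ae ?_
  rw [uIoc_of_le ht.1.le]
  -- The kernel is known to be linear only at positive times, so `s = t` is excluded.
  filter_upwards [Measure.ae_ne volume t] with s hs hsm
  have hst : 0 < t - s := sub_pos.2 (lt_of_le_of_ne hsm.2 hs)
  simp only [kernelCB_eq K.semigroup K.comp_shiftInv B hst, map_sub]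

omit [CompleteSpace Z] in
lemma tendsto_wLpNorm_orbit (hx₀ : x₀ ∈ closure (A.domain : Set X)) :
    Tendsto (fun h : ℝ => wLpNorm p α h (fun t => app C (T t x₀))) (𝓝[>] 0) (𝓝 0) :=
  AbstractKato.tendsto_wLpNorm_orbit K.semigroup K.domain_le K.comp_shiftInv K.time_pos K.one_le
    K.weight_nonneg K.exponent_pos K.condA1 hx₀

omit [CompleteSpace X] [CompleteSpace Z] in
lemma memWLp_orbit (hη : η ≤ τ) (x₀ : X) : MemWLp p α η (fun t => app C (T t x₀)) := by
  obtain ⟨M, hM⟩ := K.condA1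
  exact (hM x₀).1.mono hη

lemma app_eq_of_sub_eq_convB (hη : η ≤ τ) {x : ℝ → X}
    (hu : MemWLp (p / 2) (2 * α) η u)
    (hv : ContinuousOn v (halfOpenTime η))
    (hvcl : ∀ t ∈ halfOpenTime η, v t ∈ closure (A.domain : Set X))
    (hvu : ∀ t ∈ halfOpenTime η, embed A (v t) = convB A T B u t)
    (hxv : ∀ t ∈ halfOpenTime η, x t = T t x₀ + v t) :
    ∀ᵐ t ∂(volume.restrict (openTime η)), x t ∈ C.domain ∧
      app C (x t) = app C (T t x₀) + convCB A T B C u t := by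
  obtain ⟨M, hM⟩ := K.exists_convCB_le
  filter_upwards [(hM η u hη hu).1, ae_openTime η] with t h1 ht
  have ht' := openTime_subset_halfOpenTime ht
  obtain ⟨h2, h3⟩ := mem_domain_and_app_eq_convCB K.semigroup K.closed K.domain_le
    K.comp_shiftInv hv hvcl hvu ht (K.integrableOn hu ht') h1
  have h4 : T t x₀ ∈ C.domain := K.domain_le (K.semigroup.map_mem_domain ht.1 _)
  rw [hxv t ht', ← h3, app_add h4 h2]
  exact ⟨C.domain.add_mem h4 h2, rfl⟩

section MildSolutions

variable (hη : 0 < η) (hητ : η ≤ τ) (hx₀ : x₀ ∈ closure (A.domain : Set X))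
include hη hητ hx₀

/-- For a mild solution `x`, the function `C x` solves an integral equation, and its weighted norms
on `(0, h)` vanish as `h → 0`. -/
lemma app_mildSolution {x : ℝ → X} (hx : IsMildSolution A T B C F p α x₀ η x) :
    (∀ᵐ t ∂(volume.restrict (openTime η)), app C (x t) = app C (T t x₀) +
      convCB A T B C (fun s => F (app C (x s)) (app C (x s))) t) ∧
    Tendsto (fun h : ℝ => wLpNorm p α h (fun t => app C (x t))) (𝓝[>] 0) (𝓝 0) := by
  have hT := K.semigroup
  have hu := (wLpNorm_bilin_le F hx.memWLp hx.memWLp).1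
  have hv : ContinuousOn (fun t => x t - T t x₀) (halfOpenTime η) :=
    hx.continuousOn.sub ((hT.continuousOn_apply hx₀).mono fun t ht => ht.1)
  have hvcl : ∀ t ∈ halfOpenTime η, x t - T t x₀ ∈ closure (A.domain : Set X) := fun t ht =>
    A.domain.topologicalClosure.sub_mem (hx.mem_closure t ht) (hT.map_mem_closure hx₀ ht.1)
  have hvu : ∀ t ∈ halfOpenTime η, embed A (x t - T t x₀) =
      convB A T B (fun s => F (app C (x s)) (app C (x s))) t := fun t ht => by
    rw [map_sub, hx.integral_eq t ht, add_sub_cancel_left]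
  have heq := K.app_eq_of_sub_eq_convB hητ hu hv hvcl hvu fun t _ => (add_sub_cancel _ _).symm
  refine ⟨heq.mono fun t ht => ht.2, ?_⟩
  -- For `p = ∞` membership in the weighted space does not force vanishing at `0`; the two terms of
  -- the integral equation are treated separately.
  rcases eq_or_ne p ∞ with rfl | hp
  · obtain ⟨M, hM⟩ := K.exists_convCB_le
    have hk := hM η _ hητ hu
    have htop : (∞ : ℝ≥0∞) / 2 = ∞ := ENNReal.top_div_of_ne_top (by simp)
    have hu' := hu
    rw [htop] at hu'
    have h1 := tendsto_wLpNorm_convCB_of_top hT K.comp_shiftInv (by simpa using K.exponent_pos)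
      (by simpa using K.exponent_lt) K.condA1 K.condA2 hη hητ hv hvu hu' hk.1
    have h2 := (K.tendsto_wLpNorm_orbit hx₀).add h1
    rw [add_zero] at h2
    obtain ⟨h₀, hh₀, hh₀η⟩ := exists_real_lt hη
    refine tendsto_of_tendsto_of_tendsto_of_le_of_le' tendsto_const_nhds h2
      (Eventually.of_forall fun _ => zero_le) ?_
    filter_upwards [nhdsWithin_le_nhds (Iic_mem_nhds hh₀)] with h hh
    have hle : (h : EReal) ≤ η := (EReal.coe_le_coe_iff.2 hh).trans hh₀η.le
    rw [wLpNorm_congr (ae_openTime_mono hle (heq.mono fun t ht => ht.2))]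
    exact wLpNorm_add_le K.one_le (K.memWLp_orbit (hle.trans hητ) x₀) (hk.2.1.mono hle)
  · exact tendsto_wLpNorm_zero_of_ne_top K.one_le hp hη hx.memWLp

/-- On `(0, h)` the difference `d` of `Cx` and `Cy` satisfies `‖d‖ ≤ M‖F‖(‖Cx‖ + ‖Cy‖)‖d‖`. For
small `h` the factor is below `1`, so `d = 0` almost everywhere, and the integral equation yields `x
= y` at every time. -/
lemma eventually_eq_of_isMildSolution {x y : ℝ → X} (hx : IsMildSolution A T B C F p α x₀ η x)
    (hy : IsMildSolution A T B C F p α x₀ η y) :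
    ∀ᶠ h : ℝ in 𝓝[>] 0, ∀ t, 0 ≤ t → t < h → x t = y t := by
  obtain ⟨M, hM⟩ := K.exists_convCB_le
  obtain ⟨h₀, hh₀, hh₀η⟩ := exists_real_lt hη
  obtain ⟨hxe, hxs⟩ := K.app_mildSolution hη hητ hx₀ hx
  obtain ⟨hye, hys⟩ := K.app_mildSolution hη hητ hx₀ hy
  have hlim : Tendsto (fun h : ℝ => (M * ‖F‖₊ : ℝ≥0∞) * (wLpNorm p α h (fun t => app C (x t)) +
      wLpNorm p α h (fun t => app C (y t)))) (𝓝[>] 0) (𝓝 0) := by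
    have := ENNReal.Tendsto.const_mul (a := (M * ‖F‖₊ : ℝ≥0∞)) (hxs.add hys)
      (Or.inr (ENNReal.mul_ne_top ENNReal.coe_ne_top ENNReal.coe_ne_top))
    simpa using this
  filter_upwards [hlim.eventually (gt_mem_nhds (show (0 : ℝ≥0∞) < 1 by simp)),
    nhdsWithin_le_nhds (Iic_mem_nhds hh₀)] with h hh1 hh2
  have hle : (h : EReal) ≤ η := (EReal.coe_le_coe_iff.2 hh2).trans hh₀η.le
  have hxm := hx.memWLp.mono hle
  have hym := hy.memWLp.mono hle
  have hux := (wLpNorm_bilin_le F hxm hxm).1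
  have huy := (wLpNorm_bilin_le F hym hym).1
  have hd : (fun t => app C (x t) - app C (y t)) =ᵐ[volume.restrict (openTime (h : EReal))]
      convCB A T B C fun s => F (app C (x s)) (app C (x s)) - F (app C (y s)) (app C (y s)) := by
    filter_upwards [K.convCB_sub (hle.trans hητ) hux huy, ae_openTime_mono hle hxe,
      ae_openTime_mono hle hye] with t h1 h2 h3
    rw [h1, h2, h3, add_sub_add_left_eq_sub]
  have hdm := hxm.sub hym
  have hnorm : wLpNorm p α h (fun t => app C (x t) - app C (y t)) = 0 := by
    by_contra hne
    have h1 : wLpNorm p α h (fun t => app C (x t) - app C (y t)) ≤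
        (M * ‖F‖₊ : ℝ≥0∞) * (wLpNorm p α h (fun t => app C (x t)) +
          wLpNorm p α h (fun t => app C (y t))) *
            wLpNorm p α h (fun t => app C (x t) - app C (y t)) := by
      conv_lhs => rw [wLpNorm_congr hd]
      refine ((hM h _ (hle.trans hητ) (hux.sub huy)).2.2).trans ?_
      rw [mul_assoc, mul_assoc, ← mul_assoc (‖F‖₊ : ℝ≥0∞)]
      gcongr
      exact wLpNorm_bilin_sub_le K.two_lt.le hxm hym
    have h2 := ENNReal.mul_lt_mul_left hne hdm.wLpNorm_lt_top.ne hh1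
    rw [one_mul] at h2
    exact (h1.trans_lt h2).false
  have hae : ∀ᵐ t ∂(volume.restrict (openTime (h : EReal))), app C (x t) = app C (y t) := by
    rw [wLpNorm, eLpNorm_eq_zero_iff hdm.1 (zero_lt_one.trans_le K.one_le).ne'] at hnorm
    filter_upwards [hnorm, ae_openTime (h : EReal)] with t h1 h2
    have h3 : t ^ α ≠ 0 := (Real.rpow_pos_of_pos h2.1 _).ne'
    exact sub_eq_zero.1 ((smul_eq_zero.1 h1).resolve_left h3)
  intro t ht hth
  have hth' : (t : EReal) < (h : EReal) := EReal.coe_lt_coe_iff.2 hth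
  have ht' : t ∈ halfOpenTime η := ⟨ht, hth'.trans_le hle⟩
  apply embed_injective K.semigroup
  rw [hx.integral_eq t ht', hy.integral_eq t ht']
  congr 1
  refine convB_congr ht ?_
  filter_upwards [ae_restrict_Ioc_of_ae_openTime hth' hae] with s hs
  rw [hs]

/-- Uniqueness of mild solutions. -/
lemma eqOn_of_isMildSolution {x y : ℝ → X} (hx : IsMildSolution A T B C F p α x₀ η x)
    (hy : IsMildSolution A T B C F p α x₀ η y) : EqOn x y (halfOpenTime η) := by
  intro b hb
  have hsub : Icc 0 b ⊆ halfOpenTime η := fun s hs =>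
    ⟨hs.1, lt_of_le_of_lt (EReal.coe_le_coe_iff.2 hs.2) hb.2⟩
  have hclosed : IsClosed ({t | x t = y t} ∩ Icc 0 b) := by
    have h1 : {t | x t = y t} ∩ Icc 0 b = Icc 0 b ∩ (fun t => x t - y t) ⁻¹' {0} := by
      ext t
      simp [sub_eq_zero, and_comm]
    rw [h1]
    exact ((hx.continuousOn.sub hy.continuousOn).mono hsub).preimage_isClosed_of_isClosed
      isClosed_Icc isClosed_singleton
  have h0 : (0 : ℝ) ∈ {t | x t = y t} := by
    obtain ⟨h, h1, h2⟩ :=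
      ((K.eventually_eq_of_isMildSolution hη hητ hx₀ hx hy).and self_mem_nhdsWithin).exists
    exact h1 0 le_rfl h2
  -- Continuous induction: the coincidence set in `[0, b]` is closed, and from each of its points
  -- below `b` the restarted solutions agree a little further.
  refine hclosed.Icc_subset_of_forall_exists_gt h0 ?_ ⟨hb.1, le_rfl⟩
  rintro t₀ ⟨ht₀, htb⟩ y' hy'
  have ht₀' := hsub ⟨htb.1, htb.2.le⟩
  have hint : ∀ u : ℝ → W, MemWLp (p / 2) (2 * α) η u → ∀ t ∈ halfOpenTime η,
      IntegrableOn u (Ioc 0 t) := fun u hu t ht => K.integrableOn hu ht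
  have hxs := hx.shift K.semigroup K.weight_nonneg hint ht₀'
  have hys := hy.shift K.semigroup K.weight_nonneg hint ht₀'
  rw [← show x t₀ = y t₀ from ht₀] at hys
  have hpos : 0 < η - (t₀ : EReal) := EReal.sub_pos.2 ht₀'.2
  have hle : η - (t₀ : EReal) ≤ τ := by
    refine le_trans ?_ hητ
    rw [EReal.sub_le_iff_le_add (by simp) (by simp)]
    exact le_add_of_nonneg_right (by exact_mod_cast ht₀'.1)
  have hy'' : 0 < y' - t₀ := sub_pos.2 hy'
  obtain ⟨h, h1, h2, h3⟩ := ((K.eventually_eq_of_isMildSolution hpos hle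
    (hx.mem_closure _ ht₀') hxs hys).and (Filter.Eventually.and self_mem_nhdsWithin
      (nhdsWithin_le_nhds (Iic_mem_nhds hy'')))).exists
  have h2' : 0 < h := h2
  have h3' : h ≤ y' - t₀ := h3
  exact ⟨t₀ + h / 2, h1 (h / 2) (by positivity) (by linarith), by linarith, by linarith⟩

end MildSolutions

end KatoSetting

end AbstractKato

/-! ### Existence by contraction. -/

namespace AbstractKato

open Filter Topology

section FixedPoint

variable {Z W : Type*} [NormedAddCommGroup Z] [NormedSpace ℂ Z] [CompleteSpace Z]
  [NormedAddCommGroup W] [NormedSpace ℂ W] {p : ℝ≥0∞} {α : ℝ} {η : EReal}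

/-- A quadratic fixed point equation with small data in a weighted Lebesgue space is solvable. -/
lemma exists_quadratic_fixedPoint (hp : 2 ≤ p) (F : Z →L[ℂ] Z →L[ℂ] W) {a : ℝ → Z}
    (ha : MemWLp p α η a) {Q : (ℝ → W) → ℝ → Z} {M : ℝ≥0}
    (hQ : ∀ u, MemWLp (p / 2) (2 * α) η u → MemWLp p α η (Q u) ∧
      wLpNorm p α η (Q u) ≤ M * wLpNorm (p / 2) (2 * α) η u)
    (hQsub : ∀ u u', MemWLp (p / 2) (2 * α) η u → MemWLp (p / 2) (2 * α) η u' →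
      Q (fun s => u s - u' s) =ᵐ[volume.restrict (openTime η)] fun t => Q u t - Q u' t)
    {ε : ℝ≥0} (haε : wLpNorm p α η a ≤ ε) (hε : 8 * (M * ‖F‖₊) * ε ≤ 1) :
    ∃ y : ℝ → Z, MemWLp p α η y ∧ wLpNorm p α η y ≤ 2 * ε ∧
      y =ᵐ[volume.restrict (openTime η)] fun t => a t + Q (fun s => F (y s) (y s)) t := by
  have hp1 : 1 ≤ p := one_le_two.trans hp
  have : Fact (1 ≤ p) := ⟨hp1⟩
  set μ := volume.restrict (openTime η) with hμ
  -- Removing the weight identifies `Lp` isometrically with the weighted space, so the contraction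
  -- principle can be used in the complete space `Lp`.
  set Y : Lp Z p μ → ℝ → Z := fun g t => t ^ (-α) • g t with hY
  have hYw : ∀ g : Lp Z p μ, (fun t : ℝ => t ^ α • Y g t) =ᵐ[μ] g := fun g => by
    filter_upwards [ae_openTime η] with t ht
    simp only [hY]
    rw [smul_smul, ← Real.rpow_add ht.1, add_neg_cancel, Real.rpow_zero, one_smul]
  have hYm : ∀ g, MemWLp p α η (Y g) := fun g => (memLp_congr_ae (hYw g)).2 (Lp.memLp g)
  have hYsub : ∀ g g', wLpNorm p α η (fun t => Y g t - Y g' t) = edist g g' := fun g g' => by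
    rw [Lp.edist_def, wLpNorm]
    refine eLpNorm_congr_ae ?_
    filter_upwards [hYw g, hYw g'] with t h1 h2
    rw [smul_sub, h1, h2, Pi.sub_apply]
  have hYn : ∀ g, wLpNorm p α η (Y g) = edist g 0 := fun g => by
    rw [edist_zero_right, Lp.enorm_def, wLpNorm]
    exact eLpNorm_congr_ae (hYw g)
  have hu : ∀ g, MemWLp (p / 2) (2 * α) η fun s => F (Y g s) (Y g s) := fun g =>
    (wLpNorm_bilin_le F (hYm g) (hYm g)).1
  have hsum : ∀ g, MemWLp p α η (fun t => a t + Q (fun s => F (Y g s) (Y g s)) t) := fun g =>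
    ha.add (hQ _ (hu g)).1
  set Φ : Lp Z p μ → Lp Z p μ := fun g => MemLp.toLp _ (hsum g) with hΦ
  -- On the ball of radius `2ε` the quadratic term has norm at most `4M‖F‖ε² ≤ ε` and Lipschitz
  -- constant `4M‖F‖ε ≤ 1/2`; this accounts for the `8` in the hypothesis.
  set s : Set (Lp Z p μ) := Metric.closedEBall 0 (2 * ε) with hs
  have hε' : (8 * (M * ‖F‖₊) * ε : ℝ≥0∞) ≤ 1 := by exact_mod_cast hε
  have hmaps : MapsTo Φ s s := by
    intro g hg
    rw [hs, Metric.mem_closedEBall, ← hYn] at hg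
    have h1 : edist (Φ g) 0 = wLpNorm p α η (fun t => a t + Q (fun s => F (Y g s) (Y g s)) t) := by
      rw [edist_zero_right]
      exact Lp.enorm_toLp (hsum g)
    rw [hs, Metric.mem_closedEBall, h1]
    refine (wLpNorm_add_le hp1 ha (hQ _ (hu g)).1).trans ?_
    rw [two_mul]
    refine add_le_add haε ?_
    calc wLpNorm p α η (Q fun s => F (Y g s) (Y g s))
        ≤ M * (‖F‖₊ * wLpNorm p α η (Y g) * wLpNorm p α η (Y g)) :=
          (hQ _ (hu g)).2.trans (by gcongr; exact (wLpNorm_bilin_le F (hYm g) (hYm g)).2)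
      _ ≤ M * (‖F‖₊ * (2 * ε) * (2 * ε)) := by gcongr
      _ = 4 * (M * ‖F‖₊) * ε * ε := by ring
      _ ≤ 8 * (M * ‖F‖₊) * ε * ε := by gcongr; norm_num
      _ ≤ 1 * ε := by gcongr
      _ = ε := one_mul _
  have hcontr : ContractingWith (1 / 2) (hmaps.restrict Φ s s) := by
    refine ⟨by rw [← NNReal.coe_lt_coe]; norm_num, ?_⟩
    rintro ⟨g, hg⟩ ⟨g', hg'⟩
    rw [hs, Metric.mem_closedEBall, ← hYn] at hg hg'
    have h1 : edist (Φ g) (Φ g') =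
        wLpNorm p α η (Q fun s => F (Y g s) (Y g s) - F (Y g' s) (Y g' s)) := by
      refine (Lp.edist_toLp_toLp _ _ (hsum g) (hsum g')).trans (eLpNorm_congr_ae ?_)
      filter_upwards [hQsub _ _ (hu g) (hu g')] with t ht
      rw [ht, Pi.sub_apply, ← smul_sub, add_sub_add_left_eq_sub]
    change edist (Φ g) (Φ g') ≤ ((1 / 2 : ℝ≥0) : ℝ≥0∞) * edist g g'
    rw [h1, ← hYsub]
    set d := wLpNorm p α η fun t => Y g t - Y g' t
    calc wLpNorm p α η (Q fun s => F (Y g s) (Y g s) - F (Y g' s) (Y g' s))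
        ≤ M * (‖F‖₊ * (wLpNorm p α η (Y g) + wLpNorm p α η (Y g')) * d) :=
          (hQ _ ((hu g).sub (hu g'))).2.trans
            (by gcongr; exact wLpNorm_bilin_sub_le hp (hYm g) (hYm g'))
      _ ≤ M * (‖F‖₊ * (2 * ε + 2 * ε) * d) := by gcongr
      _ = ((1 / 2 : ℝ≥0) : ℝ≥0∞) * (8 * (M * ‖F‖₊) * ε) * d := by
          have h2 : ((1 / 2 : ℝ≥0) : ℝ≥0∞) * 8 = 4 := by
            rw [← ENNReal.coe_ofNat (n := 8), ← ENNReal.coe_mul]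
            norm_num
          have h3 : ((1 / 2 : ℝ≥0) : ℝ≥0∞) * (8 * (M * ‖F‖₊) * ε) * d =
              ((1 / 2 : ℝ≥0) : ℝ≥0∞) * 8 * (M * ‖F‖₊ * ε * d) := by
            ring
          rw [h3, h2]
          ring
      _ ≤ ((1 / 2 : ℝ≥0) : ℝ≥0∞) * 1 * d := by gcongr
      _ = ((1 / 2 : ℝ≥0) : ℝ≥0∞) * d := by rw [mul_one]
  have h0 : (0 : Lp Z p μ) ∈ s := Metric.mem_closedEBall_self
  obtain ⟨g, hg, hfix, -, -⟩ := ContractingWith.exists_fixedPoint'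
    (Metric.isClosed_closedEBall.isComplete) hmaps hcontr h0 (edist_ne_top _ _)
  refine ⟨Y g, hYm g, by rw [hYn]; exact hg, ?_⟩
  have h1 : (g : ℝ → Z) =ᵐ[μ] fun t => t ^ α • (a t + Q (fun s => F (Y g s) (Y g s)) t) := by
    have h2 := MemLp.coeFn_toLp (hsum g)
    have h3 : Φ g = g := hfix
    rw [hΦ] at h3
    beta_reduce at h3
    rwa [h3] at h2
  filter_upwards [h1, hYw g, ae_openTime η] with t h2 h3 ht
  have htα : t ^ α ≠ 0 := (Real.rpow_pos_of_pos ht.1 _).ne'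
  exact smul_right_injective Z htα (h3.trans h2)

end FixedPoint

variable {X Z W : Type*} [NormedAddCommGroup X] [NormedSpace ℂ X] [CompleteSpace X]
  [NormedAddCommGroup Z] [NormedSpace ℂ Z] [CompleteSpace Z]
  [NormedAddCommGroup W] [NormedSpace ℂ W]
  {A : X →ₗ.[ℂ] X} {T : ℝ → X →L[ℂ] X} {C : X →ₗ.[ℂ] Z} {B : W →L[ℂ] Extrap A}
  {p : ℝ≥0∞} {α : ℝ} {τ : EReal} {L : X →L[ℂ] Z}

/-- Existence of mild solutions on every interval on which the orbit of the initial value under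
`C T(·)` has a sufficiently small norm. -/
lemma KatoSetting.exists_isMildSolution (K : KatoSetting A T B C L p α τ)
    (F : Z →L[ℂ] Z →L[ℂ] W) :
    ∃ ε : ℝ≥0, 0 < ε ∧ ∀ x₀ ∈ closure (A.domain : Set X), ∀ η : EReal, 0 < η → η ≤ τ →
      wLpNorm p α η (fun t => app C (T t x₀)) ≤ ε →
      ∃ x : ℝ → X, IsMildSolution A T B C F p α x₀ η x := by
  obtain ⟨M, hM⟩ := K.exists_convCB_le
  have hT := K.semigroup
  -- The added `1` keeps the threshold meaningful when `M‖F‖ = 0`.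
  refine ⟨(8 * (M * ‖F‖₊) + 1)⁻¹, by positivity, fun x₀ hx₀ η hη hητ hsmall => ?_⟩
  set ε : ℝ≥0 := (8 * (M * ‖F‖₊) + 1)⁻¹ with hε
  have hε1 : 8 * (M * ‖F‖₊) * ε ≤ 1 := by
    rw [hε, ← div_eq_mul_inv]
    exact div_le_one_of_le₀ (le_add_of_nonneg_right zero_le_one) zero_le
  obtain ⟨y, hym, hyn, hye⟩ := exists_quadratic_fixedPoint K.two_lt.le F
    (K.memWLp_orbit hητ x₀) (fun u hu => (hM η u hητ hu).2)
    (fun u u' hu hu' => K.convCB_sub hητ hu hu') hsmall hε1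
  obtain ⟨hum, -⟩ := wLpNorm_bilin_le F hym hym
  set u : ℝ → W := fun s => F (y s) (y s) with hu
  -- The fixed point inherits vanishing at `0` from the orbit, also for `p = ∞`: on `(0, h)` its
  -- norm `b` satisfies `b ≤ a + 2M‖F‖ε b ≤ a + b/2`, hence `b ≤ 2a`, where `a`, the norm of the
  -- orbit, tends to `0`.
  have hu0 : Tendsto (fun h : ℝ => wLpNorm (p / 2) (2 * α) h u) (𝓝[>] 0) (𝓝 0) := by
    obtain ⟨h₀, hh₀, hh₀η⟩ := exists_real_lt hη
    have h1 := K.tendsto_wLpNorm_orbit hx₀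
    have h2 : Tendsto (fun h : ℝ => (‖F‖₊ : ℝ≥0∞) *
        (2 * wLpNorm p α h (fun t => app C (T t x₀))) * (2 * ε)) (𝓝[>] 0) (𝓝 0) := by
      have h3 := ENNReal.Tendsto.mul_const (b := (2 * ε : ℝ≥0∞)) (ENNReal.Tendsto.const_mul
        (a := (‖F‖₊ : ℝ≥0∞)) (ENNReal.Tendsto.const_mul (a := (2 : ℝ≥0∞)) h1
          (Or.inr (by simp))) (Or.inr ENNReal.coe_ne_top))
            (Or.inr (ENNReal.mul_ne_top (by simp) ENNReal.coe_ne_top))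
      simpa using h3
    refine tendsto_of_tendsto_of_tendsto_of_le_of_le' tendsto_const_nhds h2
      (Eventually.of_forall fun _ => zero_le) ?_
    filter_upwards [nhdsWithin_le_nhds (Iic_mem_nhds hh₀)] with h hh
    have hle : (h : EReal) ≤ η := (EReal.coe_le_coe_iff.2 hh).trans hh₀η.le
    have hym' := hym.mono hle
    have hyn' := (wLpNorm_mono hle).trans hyn
    set b := wLpNorm p α h y with hb
    set a := wLpNorm p α h (fun t => app C (T t x₀)) with ha
    have hbt : b ≠ ∞ := hym'.wLpNorm_lt_top.ne
    have hbound : b ≤ a + b / 2 := by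
      have h4 : b ≤ a + M * (‖F‖₊ * b * b) := by
        conv_lhs => rw [hb, wLpNorm_congr (ae_openTime_mono hle hye)]
        have h5 := hM h u (hle.trans hητ) (hum.mono hle)
        refine (wLpNorm_add_le K.one_le (K.memWLp_orbit (hle.trans hητ) x₀) h5.2.1).trans ?_
        gcongr
        refine h5.2.2.trans ?_
        gcongr
        exact (wLpNorm_bilin_le F hym' hym').2
      refine h4.trans ?_
      gcongr
      calc (M : ℝ≥0∞) * (‖F‖₊ * b * b) ≤ M * (‖F‖₊ * (2 * ε) * b) := by gcongr
        _ = ((2 * (M * ‖F‖₊) * ε : ℝ≥0) : ℝ≥0∞) * b := by push_cast; ring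
        _ ≤ ((1 / 2 : ℝ≥0) : ℝ≥0∞) * b := by
          gcongr
          rw [← NNReal.coe_le_coe] at hε1 ⊢
          push_cast at hε1 ⊢
          nlinarith [mul_nonneg (mul_nonneg M.coe_nonneg (norm_nonneg F)) ε.coe_nonneg]
        _ = b / 2 := by
          rw [ENNReal.div_eq_inv_mul]
          congr 1
          simp
    have hb2 : b ≤ 2 * a := by
      have h6 : b / 2 + b / 2 ≤ a + b / 2 := by rwa [ENNReal.add_halves]
      have h7 : b / 2 ≤ a :=
        (ENNReal.add_le_add_iff_right (ENNReal.div_ne_top hbt (by simp))).1 h6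
      rwa [ENNReal.div_le_iff' (by simp) (by simp)] at h7
    refine (wLpNorm_bilin_le F hym' hym').2.trans ?_
    gcongr
  obtain ⟨v, hv, hvcl, hvu⟩ := hT.exists_continuousOn_eq_convB K.weight_nonneg K.two_lt
    K.exponent_pos K.exponent_lt K.condA2 hη hητ hum hu0
  have hae := K.app_eq_of_sub_eq_convB (x := fun t => T t x₀ + v t) hητ hum hv hvcl hvu
    fun t _ => rfl
  have hCx : ∀ᵐ t ∂(volume.restrict (openTime η)), app C (T t x₀ + v t) = y t := by
    filter_upwards [hae, hye] with t h1 h2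
    rw [h1.2, h2]
  refine ⟨fun t => T t x₀ + v t, ?_, fun t ht => ?_, hae.mono fun t ht => ht.1,
    hym.congr (hCx.mono fun t ht => ht.symm), fun t ht => ?_⟩
  · exact ((hT.continuousOn_apply hx₀).mono fun t ht => ht.1).add hv
  · exact A.domain.topologicalClosure.add_mem (hT.map_mem_closure hx₀ ht.1) (hvcl t ht)
  · rw [map_add, hvu t ht]
    congr 1
    refine convB_congr ht.1 ?_
    filter_upwards [ae_restrict_Ioc_of_ae_openTime ht.2 hCx] with s hs
    rw [hs]

end AbstractKato

theorem theorem3p1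
    {X Z W : Type*}
    [NormedAddCommGroup X] [NormedSpace ℂ X] [CompleteSpace X]
    [NormedAddCommGroup Z] [NormedSpace ℂ Z] [CompleteSpace Z]
    [NormedAddCommGroup W] [NormedSpace ℂ W] [CompleteSpace W]
    (A : X →ₗ.[ℂ] X) (T : ℝ → X →L[ℂ] X)
    (hT : AbstractKato.GeneratesBoundedAnalyticSemigroup A T)
    (B : W →L[ℂ] AbstractKato.Extrap A)
    (C : X →ₗ.[ℂ] Z) (hC_closed : C.IsClosed) (hC_dom : A.domain ≤ C.domain)
    (hC_bdd : ∃ c : ℝ, ∀ x : A.domain, ‖AbstractKato.app C x‖ ≤ c * ‖(x : X) + A x‖)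
    (F : Z →L[ℂ] Z →L[ℂ] W)
    (τ : EReal) (hτ : 0 < τ) (p : ℝ≥0∞) (hp : 2 < p)
    (α : ℝ) (hα : 0 ≤ α) (hαp_pos : 0 < α + (p⁻¹).toReal) (hαp_lt : α + (p⁻¹).toReal < 1 / 2)
    (hA1 : AbstractKato.ConditionA1 T C p α τ)
    (hA2 : AbstractKato.ConditionA2 A T B p α τ)
    (hA3 : AbstractKato.ConditionA3 A T B C p α τ) :
    (∀ x₀ ∈ closure (A.domain : Set X),
      ∃ η : EReal, 0 < η ∧ η ≤ τ ∧
        ∃ x : ℝ → X, AbstractKato.IsMildSolution A T B C F p α x₀ η x) ∧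
    (∀ x₀ ∈ closure (A.domain : Set X), ∀ η : EReal, 0 < η → η ≤ τ → ∀ x y : ℝ → X,
      AbstractKato.IsMildSolution A T B C F p α x₀ η x →
      AbstractKato.IsMildSolution A T B C F p α x₀ η y →
      EqOn x y (AbstractKato.halfOpenTime η)) ∧
    (∃ δ : ℝ, 0 < δ ∧ ∀ x₀ ∈ closure (A.domain : Set X), ‖x₀‖ < δ →
      ∃ x : ℝ → X, AbstractKato.IsMildSolution A T B C F p α x₀ τ x) := by
  obtain ⟨L, hL⟩ := AbstractKato.exists_comp_shiftInv hT hC_dom hC_bdd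
  have K : AbstractKato.KatoSetting A T B C L p α τ :=
    ⟨hT, hC_closed, hC_dom, hL, hτ, hp, hα, hαp_pos, hαp_lt, hA1, hA2, hA3⟩
  obtain ⟨ε, hε, hexists⟩ := K.exists_isMildSolution F
  refine ⟨fun x₀ hx₀ => ?_, fun x₀ hx₀ η hη hητ x y hx hy =>
    K.eqOn_of_isMildSolution hη hητ hx₀ hx hy, ?_⟩
  · obtain ⟨h₀, hh₀, hh₀τ⟩ := AbstractKato.exists_real_lt hτ
    -- Local existence: shrink the interval until the orbit is below the threshold `ε`.
    obtain ⟨h, h1, h2, h3⟩ := (((K.tendsto_wLpNorm_orbit hx₀).eventually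
      (gt_mem_nhds (ENNReal.coe_pos.2 hε))).and (Filter.Eventually.and self_mem_nhdsWithin
        (nhdsWithin_le_nhds (Iic_mem_nhds hh₀)))).exists
    have hpos : (0 : EReal) < h := EReal.coe_lt_coe_iff.2 h2
    have hle : (h : EReal) ≤ τ := (EReal.coe_le_coe_iff.2 h3).trans hh₀τ.le
    exact ⟨h, hpos, hle, hexists x₀ hx₀ h hpos hle h1.le⟩
  · obtain ⟨M, hM⟩ := hA1
    -- Global existence: by [A1] the orbit has norm at most `M‖x₀‖ ≤ ε` on all of `(0, τ)`.
    refine ⟨ε / (M + 1), by positivity, fun x₀ hx₀ hlt => hexists x₀ hx₀ τ hτ le_rfl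
      ((hM x₀).2.trans ?_)⟩
    rw [lt_div_iff₀ (by positivity)] at hlt
    rw [← ofReal_norm, ← ENNReal.ofReal_coe_nnreal, ← ENNReal.ofReal_coe_nnreal,
      ← ENNReal.ofReal_mul M.coe_nonneg]
    refine ENNReal.ofReal_le_ofReal ?_
    have := norm_nonneg x₀
    nlinarith
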